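/- **Setting.** Let $r,s\ge 0$ be integers. $\mathbb R^{r,s}$ is $\mathbb R^{r+s}$ with the scalar product $\langle z,w\rangle_{r,s}=\sum_{i\le r}z_iw_i-\sum_{j\le s}z_{r+j}w_{r+j}$ and standard orthonormal basis $z_1,\dots,z_{r+s}$ (the first $r$ vectors positive, the others negative). $\mathrm{Cl}_{r,s}$ is the real Clifford algebra of $\mathbb R^{r,s}$ with the convention $z^2=-\langle z,z\rangle_{r,s}$. An *admissible module* $U=(U,\langle\cdot,\cdot\rangle_U)$ is a finite-dimensional real $\mathrm{Cl}_{r,s}$-module ($J_z$ denotes the action of $z\in\mathbb R^{r,s}$) with a nondegenerate symmetric bilinear form such that $\langle J_zx,y\rangle_U+\langle x,J_zy\rangle_U=0$ for all $x,y\in U$, $z\in\mathbb R^{r,s}$; it is *minimal* if it is nonzero and of the smallest dimension among the nonzero admissible modules of $\mathrm{Cl}_{r,s}$. The *pseudo $H$-type Lie algebra* $\mathscr N_{r,s}(U)$ is the real Lie algebra $U\oplus\mathbb R^{r,s}$ with bracket $[(x,z),(y,w)]=(0,[x,y])$, where $[x,y]\in\mathbb R^{r,s}$ is defined by $\langle J_zx,y\rangle_U=\langle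 z,[x,y]\rangle_{r,s}$ for all $z\in\mathbb R^{r,s}$. Let now $r\equiv 3\pmod 4$ and $s\equiv 0\pmod 4$. A *basic involution* is a product in $\mathrm{Cl}_{r,s}$ of four distinct basis vectors, the number of negative ones among them being even, or of three distinct basis vectors, either all three positive or one positive and two negative. Let $PI_{r,s}=\{P_1,\dots,P_m\}$ be a set of mutually commuting basic involutions, none of which is up to sign a product of others, of the maximal possible number of elements, and ordered so that $P_m$ is a product of three basis vectors and $P_1,\dots,P_{m-1}$ are products of four. On a minimal admissible module $V$, the *common $1$-eigenspace* is $E_{r,s}(V)=\{v\in V: P_iv=v,\ 1\le i\le m-1\}$. Let $V^{r,s;+}_{min;+}$ and $V^{r,s;+}_{min;-}$ be minimal admissible modules on which the volume form $\Omega^{r,s}=z_1z_2\cdots z_{r+s}$ acts as $+\mathrm{Id}$ and $-\mathrm{Id}$ respectively, both with scalar product positive definite on the common $1$-eigenspace $E_{r,s}$ (of the same system $PI_{r,s}$). Let $V^{r,s;-}_{min;\pm}$ be the module $V^{r,s;+}_{min;\pm}$ with its scalar product multiplied by $-1$. **Theorem.** Let $r\equiv 3\pmod 4$ and $s\equiv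 0\pmod 4$, and let $U$ and $\tilde U$ be admissible modules of $\mathrm{Cl}_{r,s}$ decomposed (isometrically, as $\mathrm{Cl}_{r,s}$-modules) into orthogonal direct sums $$U=\bigl(\overset{p^+_+}{\oplus}V^{r,s;+}_{min;+}\bigr)\oplus\bigl(\overset{p^-_+}{\oplus}V^{r,s;-}_{min;+}\bigr)\oplus\bigl(\overset{p^+_-}{\oplus}V^{r,s;+}_{min;-}\bigr)\oplus\bigl(\overset{p^-_-}{\oplus}V^{r,s;-}_{min;-}\bigr),$$ $$\tilde U=\bigl(\overset{\tilde p^+_+}{\oplus}V^{r,s;+}_{min;+}\bigr)\oplus\bigl(\overset{\tilde p^-_+}{\oplus}V^{r,s;-}_{min;+}\bigr)\oplus\bigl(\overset{\tilde p^+_-}{\oplus}V^{r,s;+}_{min;-}\bigr)\oplus\bigl(\overset{\tilde p^-_-}{\oplus}V^{r,s;-}_{min;-}\bigr).$$ Put $p=p^+_++p^-_-$, $q=p^-_++p^+_-$, $\tilde p=\tilde p^+_++\tilde p^-_-$, $\tilde q=\tilde p^-_++\tilde p^+_-$. Then the Lie algebras $\mathscr N_{r,s}(U)$ and $\mathscr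 N_{r,s}(\tilde U)$ are isomorphic if and only if either $p=\tilde p$ and $q=\tilde q$, or $p=\tilde q$ and $q=\tilde p$. -/

import Mathlib

namespace PseudoHType

universe u

/-! ### The space `ℝ^{r,s}` and its Clifford algebra -/

/-- Indices of the standard orthonormal basis of `ℝ^{r,s}`: first the `r` positive basis vectors,
then the `s` negative ones. -/
abbrev Idx (r s : ℕ) : Type := Fin r ⊕ Fin s

/-- The vector space underlying `ℝ^{r,s}`. -/
abbrev Vec (r s : ℕ) : Type := Idx r s → ℝ

/-- The square of the `i`-th basis vector: `1` for a positive one, `-1` for a negative one. -/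
def sgn (r s : ℕ) : Idx r s → ℝ := Sum.elim (fun _ => 1) (fun _ => -1)

/-- The quadratic form `Q_{r,s}(z) = ∑_{i ≤ r} z_i² - ∑_{j ≤ s} z_{r+j}²`. -/
noncomputable def quadForm (r s : ℕ) : QuadraticForm ℝ (Vec r s) :=
  QuadraticMap.weightedSumSquares ℝ (sgn r s)

/-- The scalar product `⟨z, w⟩_{r,s}`, the polarization of `Q_{r,s}`. -/
def scalarProd {r s : ℕ} (z w : Vec r s) : ℝ := ∑ i, sgn r s i * (z i * w i)

/-- The polarization identity. -/
theorem quadForm_add {r s : ℕ} (z w : Vec r s) :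
    quadForm r s (z + w) = quadForm r s z + quadForm r s w + 2 * scalarProd z w := by
  simp only [quadForm, scalarProd, QuadraticMap.weightedSumSquares_apply, Finset.mul_sum,
    ← Finset.sum_add_distrib, smul_eq_mul, Pi.add_apply]
  exact Finset.sum_congr rfl fun i _ => by ring

/-- The Clifford algebra `Cl_{r,s}`, with the convention `z² = -⟨z, z⟩_{r,s}`. -/
abbrev Cl (r s : ℕ) : Type := CliffordAlgebra (-quadForm r s)

/-- The inclusion `ℝ^{r,s} → Cl_{r,s}`; on a module, `J_z` is the action of `gen z`. -/
noncomputable def gen {r s : ℕ} : Vec r s →ₗ[ℝ] Cl r s := CliffordAlgebra.ι (-quadForm r s)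

theorem gen_mul_self {r s : ℕ} (z : Vec r s) :
    gen z * gen z = algebraMap ℝ (Cl r s) (-quadForm r s z) := by
  simp [gen, CliffordAlgebra.ι_sq_scalar]

/-- The basis vector `z_i`, seen in `Cl_{r,s}`. -/
noncomputable def basisGen {r s : ℕ} (i : Idx r s) : Cl r s := gen (Pi.single i 1)

/-- The product `z_{i₁} z_{i₂} ⋯ z_{iₘ}` in `Cl_{r,s}` of a list of basis vectors. -/
noncomputable def wordProd {r s : ℕ} (w : List (Idx r s)) : Cl r s := (w.map basisGen).prod

/-- The ordered volume form `Ω^{r,s} = z_1 z_2 ⋯ z_{r+s}`. -/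
noncomputable def volumeForm (r s : ℕ) : Cl r s :=
  wordProd ((List.finRange r).map Sum.inl ++ (List.finRange s).map Sum.inr)

/-! ### Admissible modules -/

section Admissible

variable (r s : ℕ) (U : Type*) [AddCommGroup U] [Module ℝ U] [Module (Cl r s) U]
  [IsScalarTower ℝ (Cl r s) U]

/-- An admissible scalar product on a Clifford module `U`: a nondegenerate symmetric bilinear form
(of any signature) for which every `J_z`, `z ∈ ℝ^{r,s}`, is skew-symmetric. -/
structure AdmissibleForm where
  form : LinearMap.BilinForm ℝ U
  symm : ∀ x y, form x y = form y x
  nondegenerate : ∀ x, (∀ y, form x y = 0) → x = 0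
  skew : ∀ (z : Vec r s) (x y : U), form (gen z • x) y + form x (gen z • y) = 0

end Admissible

section Constructions

variable {r s : ℕ}
  {U : Type*} [AddCommGroup U] [Module ℝ U] [Module (Cl r s) U] [IsScalarTower ℝ (Cl r s) U]
  {W : Type*} [AddCommGroup W] [Module ℝ W] [Module (Cl r s) W] [IsScalarTower ℝ (Cl r s) W]

namespace AdmissibleForm

/-- The same Clifford module with the scalar product of the opposite sign. -/
noncomputable def neg (g : AdmissibleForm r s U) : AdmissibleForm r s U where
  form := -g.form
  symm x y := by simp [g.symm x y]
  nondegenerate x h := g.nondegenerate x fun y => by simpa using h y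
  skew z x y := by
    have := g.skew z x y
    simp only [LinearMap.neg_apply]
    linarith

/-- The orthogonal direct sum of two admissible modules. -/
noncomputable def prod (g : AdmissibleForm r s U) (h : AdmissibleForm r s W) :
    AdmissibleForm r s (U × W) where
  form := LinearMap.mk₂ ℝ (fun x y => g.form x.1 y.1 + h.form x.2 y.2)
    (fun x x' y => by simp; ring) (fun c x y => by simp; ring)
    (fun x y y' => by simp; ring) (fun c x y => by simp; ring)
  symm x y := by simp [g.symm x.1 y.1, h.symm x.2 y.2]
  nondegenerate x hx := Prod.ext
    (g.nondegenerate _ fun y => by simpa using hx (y, 0))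
    (h.nondegenerate _ fun y => by simpa using hx (0, y))
  skew z x y := by
    have h1 := g.skew z x.1 y.1
    have h2 := h.skew z x.2 y.2
    simp only [LinearMap.mk₂_apply, Prod.smul_fst, Prod.smul_snd]
    linarith

/-- The orthogonal direct sum of `n` copies of an admissible module. -/
noncomputable def copies (n : ℕ) (g : AdmissibleForm r s U) :
    AdmissibleForm r s (Fin n → U) where
  form := LinearMap.mk₂ ℝ (fun x y => ∑ i, g.form (x i) (y i))
    (fun x x' y => by simp [Finset.sum_add_distrib]) (fun c x y => by simp [Finset.mul_sum])
    (fun x y y' => by simp [Finset.sum_add_distrib]) (fun c x y => by simp [Finset.mul_sum])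
  symm x y := by simp [g.symm]
  nondegenerate x hx := funext fun i => g.nondegenerate _ fun y => by
    have := hx (Pi.single i y)
    simp only [LinearMap.mk₂_apply] at this
    rw [Finset.sum_eq_single i] at this
    · simpa using this
    · intro j _ hj
      simp [hj]
    · simp
  skew z x y := by
    simp only [LinearMap.mk₂_apply, Pi.smul_apply, ← Finset.sum_add_distrib, g.skew,
      Finset.sum_const_zero]

/-- Isomorphism of admissible modules: a `Cl_{r,s}`-linear bijection which preserves the scalar
products. -/
def Iso (g : AdmissibleForm r s U) (h : AdmissibleForm r s W) : Prop :=
  ∃ e : U ≃ₗ[Cl r s] W, ∀ x y, h.form (e x) (e y) = g.form x y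

end AdmissibleForm

end Constructions

/-- A minimal admissible module: a nonzero finite-dimensional Clifford module with an admissible
scalar product, of the smallest dimension among all such modules. -/
def AdmissibleForm.IsMinimal {r s : ℕ} {V : Type u} [AddCommGroup V] [Module ℝ V]
    [Module (Cl r s) V] [IsScalarTower ℝ (Cl r s) V] (_g : AdmissibleForm r s V) : Prop :=
  Nontrivial V ∧ FiniteDimensional ℝ V ∧
    ∀ (W : Type u) [AddCommGroup W] [Module ℝ W] [Module (Cl r s) W] [IsScalarTower ℝ (Cl r s) W],
      AdmissibleForm r s W → Nontrivial W → FiniteDimensional ℝ W →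
        Module.finrank ℝ V ≤ Module.finrank ℝ W

/-! ### Systems of involutions and the common `1`-eigenspace -/

section Involutions

variable {r s : ℕ}

/-- The words `z_{i₁} ⋯ z_{iₘ}` in distinct basis vectors giving the basic isometric involutions:
products of four basis vectors which are all positive, all negative, or two and two; products of
three positive basis vectors; products of one positive and two negative basis vectors. In all these
cases, and in no others, `m ∈ {3, 4}` and the number of negative basis vectors is even. -/
def IsBasicInvolution (w : List (Idx r s)) : Prop :=
  w.Nodup ∧ (w.length = 3 ∨ w.length = 4) ∧ Even (w.countP Sum.isRight)

/-- A finite family of mutually commuting basic involutions, none of which is, up to sign, a product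
of others. -/
structure IsCommutingSystem {k : ℕ} (P : Fin k → List (Idx r s)) : Prop where
  basic : ∀ i, IsBasicInvolution (P i)
  commute : ∀ i j, Commute (wordProd (P i)) (wordProd (P j))
  not_product : ∀ (i : Fin k) (l : List (Fin k)), i ∉ l →
    wordProd (P i) ≠ (l.map fun j => wordProd (P j)).prod ∧
    wordProd (P i) ≠ -(l.map fun j => wordProd (P j)).prod

/-- A system `PI_{r,s}`, in the case `r - s ≡ 3 (mod 4)`, `s` even: a commuting system with the
maximal number of involutions, ordered so that its last member, and no other one, is a product of
three basis vectors. -/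
structure IsInvolutionSystem {k : ℕ} (P : Fin (k + 1) → List (Idx r s)) : Prop where
  system : IsCommutingSystem P
  maximal : ∀ (m : ℕ) (P' : Fin m → List (Idx r s)), IsCommutingSystem P' → m ≤ k + 1
  length_init : ∀ i : Fin k, (P i.castSucc).length = 4
  length_last : (P (Fin.last k)).length = 3

/-- The common `1`-eigenspace `E_{r,s}`, in the case `r - s ≡ 3 (mod 4)`, `s` even: the vectors
fixed by all involutions of the system except the last one. -/
def commonEigenspace {k : ℕ} (P : Fin (k + 1) → List (Idx r s)) (V : Type*) [AddCommGroup V]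
    [Module (Cl r s) V] : Set V :=
  {v | ∀ i : Fin k, wordProd (P i.castSucc) • v = v}

end Involutions

/-! ### Pseudo `H`-type Lie algebras -/

section LieAlgebra

set_option linter.unusedSectionVars false

variable {r s : ℕ}
  {U : Type*} [AddCommGroup U] [Module ℝ U] [Module (Cl r s) U] [IsScalarTower ℝ (Cl r s) U]

/-- The vector space `U ⊕ ℝ^{r,s}` underlying the pseudo `H`-type Lie algebra `N_{r,s}(U)`. -/
def HTypeAlgebra (_g : AdmissibleForm r s U) : Type _ := U × Vec r s

namespace HTypeAlgebra

/-- The skew-symmetric form `[x, y] ∈ ℝ^{r,s}`, in coordinates; see `form_gen_smul` for the defining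
relation. -/
noncomputable def bracket (g : AdmissibleForm r s U) (x y : U) : Vec r s :=
  fun i => sgn r s i * g.form (basisGen i • x) y

/-- `[x, y]` is characterized by `⟨J_z x, y⟩_U = ⟨z, [x, y]⟩_{r,s}` for all `z`. -/
theorem form_gen_smul (g : AdmissibleForm r s U) (z : Vec r s) (x y : U) :
    g.form (gen z • x) y = scalarProd z (bracket g x y) := by
  have hz : z = ∑ i, z i • (Pi.single i 1 : Vec r s) := by
    ext j
    simp [Finset.sum_apply, Pi.single_apply]
  have hs : ∀ i, sgn r s i * sgn r s i = 1 := by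
    rintro (i | i) <;> simp [sgn]
  conv_lhs => rw [hz]
  simp only [map_sum, map_smul, Finset.sum_smul, smul_assoc, LinearMap.sum_apply,
    LinearMap.smul_apply, scalarProd, bracket, basisGen, smul_eq_mul]
  refine Finset.sum_congr rfl fun i _ => ?_
  linear_combination (-(z i * g.form ((gen (Pi.single i 1 : Vec r s)) • x) y)) * hs i

variable (g : AdmissibleForm r s U)

instance : AddCommGroup (HTypeAlgebra g) := inferInstanceAs (AddCommGroup (U × Vec r s))

instance : Module ℝ (HTypeAlgebra g) := inferInstanceAs (Module ℝ (U × Vec r s))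

theorem bracket_self (x : U) : bracket g x x = 0 := by
  funext i
  have h := g.skew (Pi.single i 1) x x
  rw [g.symm x] at h
  have h' : g.form (basisGen i • x) x = 0 := by
    unfold basisGen
    linarith
  simp [bracket, h']

theorem bracket_add_left (x x' y : U) :
    bracket g (x + x') y = bracket g x y + bracket g x' y := by
  funext i
  simp [bracket, mul_add]

theorem bracket_add_right (x y y' : U) :
    bracket g x (y + y') = bracket g x y + bracket g x y' := by
  funext i
  simp [bracket, mul_add]

theorem bracket_smul_right (c : ℝ) (x y : U) : bracket g x (c • y) = c • bracket g x y := by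
  funext i
  simp [bracket]
  ring

theorem bracket_zero_left (y : U) : bracket g 0 y = 0 := by
  funext i
  simp [bracket]

theorem bracket_zero_right (x : U) : bracket g x 0 = 0 := by
  funext i
  simp [bracket]

/-- The Lie bracket `[(x, z), (y, w)] = (0, [x, y])`. -/
noncomputable instance : Bracket (HTypeAlgebra g) (HTypeAlgebra g) where
  bracket a b := ((0 : U), bracket g a.1 b.1)

theorem lie_def (a b : HTypeAlgebra g) : ⁅a, b⁆ = ((0 : U), bracket g a.1 b.1) := rfl

noncomputable instance : LieRing (HTypeAlgebra g) where
  add_lie a b c := Prod.ext (add_zero (0 : U)).symm (bracket_add_left g a.1 b.1 c.1)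
  lie_add a b c := Prod.ext (add_zero (0 : U)).symm (bracket_add_right g a.1 b.1 c.1)
  lie_self a := Prod.ext rfl (bracket_self g a.1)
  leibniz_lie a b c := by
    refine Prod.ext (add_zero (0 : U)).symm ?_
    change bracket g a.1 0 = bracket g 0 c.1 + bracket g b.1 0
    simp [bracket_zero_left, bracket_zero_right]

noncomputable instance : LieAlgebra ℝ (HTypeAlgebra g) where
  lie_smul c a b := Prod.ext (smul_zero c).symm (bracket_smul_right g c a.1 b.1)

end HTypeAlgebra

end LieAlgebra

end PseudoHType

namespace PseudoHType

/-! ### Products of basis vectors -/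

section Words

variable {r s : ℕ}

/-! Write `V` for the minimal module on which the volume form Ω is the identity. Everything reduces
to sums of `p` copies of `V` and `q` copies of its negative.

Uniqueness of minimal modules is a GNS argument. The group generated by the involutions of length
four is enlarged to a maximal group `G` of self-adjoint even words without `-1`. Averaging over `G`
has trace `dim V`, so there is a nonzero `G`-fixed vector `v`. On even words the functional `a ↦ ⟨a
v, v⟩` is forced: `±⟨v, v⟩` on `±G` and `0` elsewhere. Since `r + s` is odd and Ω is a scalar, odd
words follow (`IsSaturated.form_eq`). By minimality `v` is cyclic, so the functional determines
module and form up to scale (`exists_equiv_of_form_eq`). In particular an isometry between the two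
minimal modules reverses the sign of every `J_z` (`exists_antilinear_isometry`). It reverses
brackets, which explains how the four multiplicities combine into `p` and `q`. Negating the center
exchanges `p` and `q`.

Conversely, a Lie isomorphism yields linear maps `A` on the modules and `C` on the centers.
Comparing determinants of the `J_z` shows that the adjoint of `C` is a similarity of the quadratic
form, and centrality of Ω shows that `A` scales the module form and intertwines the actions up to a
Clifford automorphism σ (`exists_equiv_of_lieEquiv`). Uniqueness, applied to `V` twisted by σ,
removes σ (`exists_twisted_automorphism`). What remains is a Clifford-linear bijection scaling the
forms, and inertia on the common eigenspace recovers `p` and `q` up to exchange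
(`eq_of_form_scaling`). -/

instance : LawfulBEq (Idx r s) where
  eq_of_beq {a b} h := by
    rcases a with a | a <;> rcases b with b | b <;> first | cases h | skip
    · exact congrArg Sum.inl (eq_of_beq (α := Fin r) h)
    · exact congrArg Sum.inr (eq_of_beq (α := Fin s) h)
  rfl {a} := by
    rcases a with a | a
    · exact beq_self_eq_true (α := Fin r) a
    · exact beq_self_eq_true (α := Fin s) a

/-- Two elements of the Clifford algebra agree up to sign. -/
def EqUpToSign (x y : Cl r s) : Prop := x = y ∨ x = -y

namespace EqUpToSign

theorem refl (x : Cl r s) : EqUpToSign x x := Or.inl rfl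

theorem symm {x y : Cl r s} (h : EqUpToSign x y) : EqUpToSign y x := by
  rcases h with rfl | rfl
  · exact Or.inl rfl
  · exact Or.inr (neg_neg _).symm

theorem trans {x y z : Cl r s} (h : EqUpToSign x y) (h' : EqUpToSign y z) : EqUpToSign x z := by
  rcases h with rfl | rfl <;> rcases h' with rfl | rfl <;> simp [EqUpToSign]

theorem mul {x y x' y' : Cl r s} (h : EqUpToSign x y) (h' : EqUpToSign x' y') :
    EqUpToSign (x * x') (y * y') := by
  rcases h with rfl | rfl <;> rcases h' with rfl | rfl <;> simp [EqUpToSign]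

end EqUpToSign

theorem sgn_eq (i : Idx r s) : sgn r s i = 1 ∨ sgn r s i = -1 := by
  rcases i with i | i <;> simp [sgn]

theorem sgn_mul_self (i : Idx r s) : sgn r s i * sgn r s i = 1 := by
  rcases i with i | i <;> simp [sgn]

theorem quadForm_apply (z : Vec r s) : quadForm r s z = ∑ i, sgn r s i * (z i * z i) := by
  simp [quadForm, QuadraticMap.weightedSumSquares_apply]

theorem quadForm_single (i : Idx r s) : quadForm r s (Pi.single i 1) = sgn r s i := by
  rw [quadForm_apply, Finset.sum_eq_single i]
  · simp
  · intro j _ hj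
    simp [hj]
  · simp

theorem basisGen_mul_self (i : Idx r s) :
    basisGen i * basisGen i = algebraMap ℝ (Cl r s) (-sgn r s i) := by
  rw [basisGen, gen_mul_self, quadForm_single]

theorem basisGen_mul_comm {i j : Idx r s} (h : i ≠ j) :
    (basisGen i * basisGen j : Cl r s) = -(basisGen j * basisGen i) := by
  refine CliffordAlgebra.ι_mul_ι_comm_of_isOrtho ?_
  rw [QuadraticMap.isOrtho_def]
  simp only [neg_apply, quadForm_add, scalarProd]
  rw [Finset.sum_eq_zero]
  · ring
  · intro l _
    rcases eq_or_ne l i with rfl | hl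
    · simp [h]
    · simp [hl]

@[simp] theorem wordProd_nil : wordProd ([] : List (Idx r s)) = 1 := rfl

@[simp] theorem wordProd_cons (i : Idx r s) (w : List (Idx r s)) :
    wordProd (i :: w) = basisGen i * wordProd w := by
  simp [wordProd]

@[simp] theorem wordProd_append (w w' : List (Idx r s)) :
    wordProd (w ++ w') = wordProd w * wordProd w' := by
  simp [wordProd]

theorem basisGen_sq_upToSign (i : Idx r s) :
    EqUpToSign (basisGen i * basisGen i : Cl r s) 1 := by
  rw [basisGen_mul_self]
  rcases sgn_eq i with h | h <;> simp [h, EqUpToSign]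

theorem wordProd_perm {w w' : List (Idx r s)} (h : w.Perm w') :
    EqUpToSign (wordProd w) (wordProd w') := by
  induction h with
  | nil => exact .refl _
  | cons x _ ih => simpa using (EqUpToSign.refl (basisGen x)).mul ih
  | swap x y l =>
    rcases eq_or_ne x y with rfl | hxy
    · exact .refl _
    · right
      simp only [wordProd_cons, ← mul_assoc]
      rw [basisGen_mul_comm hxy, neg_mul, neg_neg]
  | trans _ _ ih ih' => exact ih.trans ih'

/-- The indices occurring an odd number of times in a word. -/
def oddSupp (w : List (Idx r s)) : Finset (Idx r s) := Finset.univ.filter fun i => Odd (w.count i)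

theorem basisGen_mul_wordProd_toList (i : Idx r s) (S : Finset (Idx r s)) :
    EqUpToSign (basisGen i * wordProd S.toList)
      (wordProd (if i ∈ S then S.erase i else insert i S).toList) := by
  split_ifs with h
  · have h1 : S.toList.Perm (i :: (S.erase i).toList) := by
      conv_lhs => rw [← Finset.insert_erase h]
      exact Finset.toList_insert (Finset.notMem_erase i S)
    refine ((EqUpToSign.refl _).mul (wordProd_perm h1)).trans ?_
    rw [wordProd_cons, ← mul_assoc]
    simpa using (basisGen_sq_upToSign i).mul (EqUpToSign.refl (wordProd (S.erase i).toList))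
  · rw [← wordProd_cons]
    exact (wordProd_perm (Finset.toList_insert h)).symm

/-- Up to sign, basis vectors commute and square to `1`, so words multiply like finite sets under
symmetric difference. Only finitely many signed words exist. -/
theorem wordProd_normalForm (w : List (Idx r s)) :
    EqUpToSign (wordProd w) (wordProd (oddSupp w).toList) := by
  induction w with
  | nil => simp [oddSupp, EqUpToSign]
  | cons i w ih =>
    rw [wordProd_cons]
    refine ((EqUpToSign.refl _).mul ih).trans
      ((basisGen_mul_wordProd_toList i _).trans (Or.inl ?_))
    congr 2
    ext j
    rcases eq_or_ne j i with rfl | hj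
    · split_ifs with h <;> simp [oddSupp] at h ⊢
      · exact Odd.add_one h
      · exact Even.add_one h
    · split_ifs with h <;> simp [oddSupp, hj, List.count_cons, hj.symm]

theorem wordProd_parity {w w' : List (Idx r s)}
    (h : ∀ i, (Odd (w.count i) ↔ Odd (w'.count i))) : EqUpToSign (wordProd w) (wordProd w') := by
  refine (wordProd_normalForm w).trans ?_
  have : oddSupp w = oddSupp w' := by simp [oddSupp, h]
  rw [this]
  exact (wordProd_normalForm w').symm

theorem wordProd_sq (w : List (Idx r s)) : EqUpToSign (wordProd w * wordProd w) 1 := by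
  rw [← wordProd_append, ← wordProd_nil]
  exact wordProd_parity fun i => by simp [List.count_append]

theorem wordProd_comm (w w' : List (Idx r s)) :
    EqUpToSign (wordProd w * wordProd w') (wordProd w' * wordProd w) := by
  rw [← wordProd_append, ← wordProd_append]
  exact wordProd_perm List.perm_append_comm

/-- Each letter different from `i` contributes a factor `-1`. The exponent `length + count` has the
same parity as the number of these letters, `length - count`. -/
theorem basisGen_mul_wordProd (i : Idx r s) (w : List (Idx r s)) :
    basisGen i * wordProd w = (-1) ^ (w.length + w.count i) * (wordProd w * basisGen i) := by
  induction w with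
  | nil => simp
  | cons j w ih =>
    rcases eq_or_ne j i with rfl | hj
    · simp only [wordProd_cons, List.length_cons, List.count_cons_self]
      rw [show w.length + 1 + (w.count j + 1) = w.length + w.count j + 2 by ring, pow_add]
      simp only [even_two, Even.neg_pow, one_pow, mul_one]
      conv_lhs => rw [ih]
      simp only [← mul_assoc]
      congr 2
      exact (Commute.neg_one_right (basisGen j : Cl r s)).pow_right _
    · simp only [wordProd_cons, List.length_cons, List.count_cons_of_ne hj]
      rw [← mul_assoc, basisGen_mul_comm hj.symm, neg_mul, mul_assoc, ih,
        show w.length + 1 + w.count i = w.length + w.count i + 1 by ring, pow_succ]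
      simp only [← mul_assoc, mul_neg, mul_one, neg_mul, neg_inj]
      congr 2
      exact (Commute.neg_one_right (basisGen j : Cl r s)).pow_right _

theorem star_wordProd (w : List (Idx r s)) : EqUpToSign (star (wordProd w)) (wordProd w) := by
  induction w with
  | nil => simp [EqUpToSign]
  | cons i w ih =>
    have hi : star (basisGen i : Cl r s) = -basisGen i := CliffordAlgebra.star_ι _
    rw [wordProd_cons, star_mul, hi]
    refine (ih.mul (Or.inr rfl : EqUpToSign _ (basisGen i))).trans ?_
    simpa using wordProd_comm w [i]

theorem finite_upToSign_words :
    {x : Cl r s | ∃ w, EqUpToSign x (wordProd w)}.Finite := by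
  refine ((Set.finite_range fun S : Finset (Idx r s) => wordProd S.toList).union
    (Set.finite_range fun S : Finset (Idx r s) => -wordProd S.toList)).subset ?_
  rintro x ⟨w, hw⟩
  rcases hw.trans (wordProd_normalForm w) with h | h
  · exact Or.inl ⟨_, h.symm⟩
  · exact Or.inr ⟨_, h.symm⟩

theorem gen_eq_sum (z : Vec r s) : gen z = ∑ i, z i • (basisGen i : Cl r s) := by
  have hz : z = ∑ i, z i • (Pi.single i 1 : Vec r s) := by
    ext j
    simp [Finset.sum_apply, Pi.single_apply]
  conv_lhs => rw [hz]
  simp [basisGen]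

theorem span_words : Submodule.span ℝ (Set.range (wordProd : List (Idx r s) → Cl r s)) = ⊤ := by
  set N := Submodule.span ℝ (Set.range (wordProd : List (Idx r s) → Cl r s)) with hN
  have hmul : ∀ x ∈ N, ∀ y ∈ N, x * y ∈ N := by
    intro x hx y hy
    have : N * N ≤ N := by
      rw [hN, Submodule.span_mul_span]
      refine Submodule.span_mono ?_
      rintro _ ⟨_, ⟨w, rfl⟩, _, ⟨w', rfl⟩, rfl⟩
      exact ⟨w ++ w', by simp⟩
    exact this (Submodule.mul_mem_mul hx hy)
  have h1 : (1 : Cl r s) ∈ N := Submodule.subset_span ⟨[], rfl⟩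
  rw [eq_top_iff]
  rintro a -
  induction a using CliffordAlgebra.induction with
  | algebraMap c => rw [Algebra.algebraMap_eq_smul_one]; exact N.smul_mem _ h1
  | ι z =>
    change gen z ∈ N
    rw [gen_eq_sum]
    exact N.sum_mem fun i _ => N.smul_mem _ (Submodule.subset_span ⟨[i], by simp⟩)
  | mul a b ha hb => exact hmul a ha b hb
  | add a b ha hb => exact N.add_mem ha hb

/-- The basis vectors in the volume form. -/
def volumeWord (r s : ℕ) : List (Idx r s) :=
  (List.finRange r).map Sum.inl ++ (List.finRange s).map Sum.inr

theorem volumeForm_eq : volumeForm r s = wordProd (volumeWord r s) := rfl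

theorem length_volumeWord : (volumeWord r s).length = r + s := by simp [volumeWord]

theorem count_volumeWord (i : Idx r s) : (volumeWord r s).count i = 1 := by
  refine List.count_eq_one_of_mem ?_ ?_
  · refine List.Nodup.append ((List.nodup_finRange r).map Sum.inl_injective)
      ((List.nodup_finRange s).map Sum.inr_injective) ?_
    simp [List.disjoint_left]
  · rcases i with i | i <;> simp [volumeWord]

end Words

/-! ### Groups of self-adjoint even words -/

section InvolutionGroups

variable {r s : ℕ}

theorem star_basisGen (i : Idx r s) : star (basisGen i : Cl r s) = -basisGen i :=
  CliffordAlgebra.star_ι _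

/-- Each letter contributes `z_i · star z_i = -z_i² = ±1`, with `-1` exactly for negative letters.
For self-adjoint words this computes the square. -/
theorem wordProd_mul_star (w : List (Idx r s)) :
    wordProd w * star (wordProd w) = algebraMap ℝ (Cl r s) ((-1) ^ w.countP Sum.isRight) := by
  induction w with
  | nil => simp
  | cons i w ih =>
    rw [wordProd_cons, star_mul, mul_assoc, ← mul_assoc (wordProd w), ih, star_basisGen,
      Algebra.commutes, ← mul_assoc, mul_neg, basisGen_mul_self, ← map_neg, ← map_mul]
    congr 1
    rcases i with i | i <;> simp [sgn, List.countP_cons, pow_succ]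

theorem star_wordProd_of_length_four {w : List (Idx r s)} (hw : w.Nodup) (h4 : w.length = 4) :
    star (wordProd w) = wordProd w := by
  obtain ⟨a, b, c, d, rfl⟩ : ∃ a b c d, w = [a, b, c, d] := by
    match w, h4 with
    | [a, b, c, d], _ => exact ⟨a, b, c, d, rfl⟩
  simp only [List.nodup_cons, List.mem_cons, List.not_mem_nil, or_false, not_or] at hw
  obtain ⟨⟨hab, hac, had⟩, ⟨hbc, hbd⟩, hcd, -⟩ := hw
  have h1 := basisGen_mul_wordProd d [a, b, c]
  have h2 := basisGen_mul_wordProd c [a, b]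
  simp only [List.length_cons, List.length_nil, List.count_cons_of_ne had,
    List.count_cons_of_ne hbd, List.count_cons_of_ne hcd, List.count_nil, wordProd_cons,
    wordProd_nil, mul_one] at h1
  simp only [List.length_cons, List.length_nil, List.count_cons_of_ne hac,
    List.count_cons_of_ne hbc, List.count_nil, wordProd_cons, wordProd_nil, mul_one] at h2
  norm_num at h1 h2
  simp only [wordProd_cons, wordProd_nil, mul_one, star_mul, star_basisGen, neg_mul, mul_neg,
    neg_neg]
  simp only [mul_assoc] at h1 h2 ⊢
  rw [basisGen_mul_comm (Ne.symm hab)]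
  simp only [mul_neg]
  rw [h2, h1, neg_neg]

theorem wordProd_sq_of_length_four {w : List (Idx r s)} (hw : IsBasicInvolution w)
    (h4 : w.length = 4) : wordProd w * wordProd w = 1 := by
  have h := wordProd_mul_star w
  rwa [star_wordProd_of_length_four hw.1 h4, hw.2.2.neg_one_pow, map_one] at h

/-- A multiplicatively closed set of self-adjoint even words, up to sign, not containing `-1`. Its
elements are commuting involutions. -/
structure IsInvolutionGroup (G : Set (Cl r s)) : Prop where
  one_mem : 1 ∈ G
  mul_mem : ∀ x ∈ G, ∀ y ∈ G, x * y ∈ G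
  even_word : ∀ x ∈ G, ∃ w : List (Idx r s), Even w.length ∧ EqUpToSign x (wordProd w)
  star_eq : ∀ x ∈ G, star x = x
  neg_one_notMem : -1 ∉ G

/-- A group of involutions which cannot be enlarged. -/
structure IsSaturated (G : Set (Cl r s)) : Prop extends IsInvolutionGroup G where
  saturated : ∀ w : List (Idx r s), Even w.length → star (wordProd w) = wordProd w →
    (∀ g ∈ G, Commute g (wordProd w)) → wordProd w * wordProd w = 1 →
    wordProd w ∈ G ∨ -wordProd w ∈ G

namespace IsInvolutionGroup

variable {G : Set (Cl r s)}

theorem commute (hG : IsInvolutionGroup G) {x y : Cl r s} (hx : x ∈ G) (hy : y ∈ G) :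
    Commute x y := by
  have h := hG.star_eq _ (hG.mul_mem x hx y hy)
  rw [star_mul, hG.star_eq x hx, hG.star_eq y hy] at h
  exact h.symm

theorem mul_self (hG : IsInvolutionGroup G) {x : Cl r s} (hx : x ∈ G) : x * x = 1 := by
  obtain ⟨w, -, hw⟩ := hG.even_word x hx
  rcases (hw.mul hw).trans (wordProd_sq w) with h | h
  · exact h
  · exact absurd (h ▸ hG.mul_mem x hx x hx) hG.neg_one_notMem

theorem finite (hG : IsInvolutionGroup G) : G.Finite :=
  finite_upToSign_words.subset fun x hx =>
    let ⟨w, _, h⟩ := hG.even_word x hx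
    ⟨w, h⟩

theorem adjoin (hG : IsInvolutionGroup G) {w : List (Idx r s)} (hw : Even w.length)
    (hstar : star (wordProd w) = wordProd w) (hcomm : ∀ g ∈ G, Commute g (wordProd w))
    (hsq : wordProd w * wordProd w = 1) (hneg : -wordProd w ∉ G) :
    IsInvolutionGroup (G ∪ (fun g => g * wordProd w) '' G) where
  one_mem := Or.inl hG.one_mem
  mul_mem := by
    rintro x (hx | ⟨x, hx, rfl⟩) y (hy | ⟨y, hy, rfl⟩)
    · exact Or.inl (hG.mul_mem x hx y hy)
    · exact Or.inr ⟨x * y, hG.mul_mem x hx y hy, by simp only [mul_assoc]⟩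
    · refine Or.inr ⟨x * y, hG.mul_mem x hx y hy, ?_⟩
      simp only [mul_assoc, (hcomm y hy).eq]
    · refine Or.inl ?_
      have : x * wordProd w * (y * wordProd w) = x * y := by
        rw [mul_assoc, ← mul_assoc (wordProd w), ← (hcomm y hy).eq, mul_assoc y, hsq, mul_one]
      simp only [this]
      exact hG.mul_mem x hx y hy
  even_word := by
    rintro x (hx | ⟨x, hx, rfl⟩)
    · exact hG.even_word x hx
    · obtain ⟨v, hv, hxv⟩ := hG.even_word x hx
      exact ⟨v ++ w, by simp [hv.add hw], by simpa using hxv.mul (.refl (wordProd w))⟩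
  star_eq := by
    rintro x (hx | ⟨x, hx, rfl⟩)
    · exact hG.star_eq x hx
    · simp only [star_mul, hstar, hG.star_eq x hx, (hcomm x hx).eq]
  neg_one_notMem := by
    rintro (h | ⟨x, hx, h⟩)
    · exact hG.neg_one_notMem h
    · apply hneg
      have : x * (x * wordProd w) = -x := by
        simp only at h
        rw [h, mul_neg, mul_one]
      rw [← mul_assoc, hG.mul_self hx, one_mul] at this
      rwa [this, neg_neg]

/-- All such groups lie in the finite set of signed words, so a maximal one exists above `G`. By
`adjoin`, a word violating saturation would enlarge it. -/
theorem exists_isSaturated (hG : IsInvolutionGroup G) : ∃ G', G ⊆ G' ∧ IsSaturated G' := by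
  have hfin : {G' : Set (Cl r s) | IsInvolutionGroup G'}.Finite := by
    refine (finite_upToSign_words (r := r) (s := s)).finite_subsets.subset ?_
    intro G' hG' x hx
    obtain ⟨w, -, h⟩ := hG'.even_word x hx
    exact ⟨w, h⟩
  obtain ⟨G', hle, hmax⟩ := hfin.exists_le_maximal hG
  refine ⟨G', hle, hmax.prop, fun w hw hstar hcomm hsq => ?_⟩
  by_contra! hcon
  have h := hmax.le_of_ge (hmax.prop.adjoin hw hstar hcomm hsq hcon.2) Set.subset_union_left
  exact hcon.1 (h (Or.inr ⟨1, hmax.prop.one_mem, one_mul _⟩))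

end IsInvolutionGroup

/-- The products of the involutions of a system except the last one. -/
def systemGroup {k : ℕ} (P : Fin (k + 1) → List (Idx r s)) : Set (Cl r s) :=
  Set.range fun l : List (Fin k) => (l.map fun j => wordProd (P j.castSucc)).prod

/-- In a shortest product equal to `-1` no factor repeats, since two equal commuting involutions
cancel. The first factor is then minus the product of the others, against independence up to sign.
-/
theorem IsInvolutionSystem.prod_ne_neg_one {k : ℕ} {P : Fin (k + 1) → List (Idx r s)}
    (hP : IsInvolutionSystem P) [Nontrivial (Cl r s)] :
    ∀ (n : ℕ) (l : List (Fin k)), l.length = n →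
      (l.map fun j => wordProd (P j.castSucc)).prod ≠ -1 := by
  have hsq : ∀ i : Fin k, wordProd (P i.castSucc) * wordProd (P i.castSucc) = 1 := fun i =>
    wordProd_sq_of_length_four (hP.system.basic _) (hP.length_init i)
  intro n
  induction n using Nat.strong_induction_on with
  | _ n ih =>
    rintro (_ | ⟨i, t⟩) hl h
    · have h2 : (algebraMap ℝ (Cl r s)) 2 = 0 := by
        rw [← one_add_one_eq_two, map_add, map_one]
        nth_rewrite 1 [show (1 : Cl r s) = -1 from h]
        exact neg_add_cancel 1
      exact two_ne_zero ((map_eq_zero _).1 h2)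
    · by_cases hi : i ∈ t
      · have hperm : t.Perm (i :: t.erase i) := List.perm_cons_erase hi
        have hprod : (t.map fun j => wordProd (P j.castSucc)).prod =
            ((i :: t.erase i).map fun j => wordProd (P j.castSucc)).prod := by
          refine (hperm.map _).prod_eq' ?_
          rw [List.pairwise_map]
          exact List.pairwise_of_forall fun a b => hP.system.commute _ _
        rw [List.map_cons, List.prod_cons, hprod, List.map_cons, List.prod_cons, ← mul_assoc,
          hsq, one_mul] at h
        refine ih _ ?_ (t.erase i) rfl h
        have := List.length_erase_of_mem hi
        simp only [List.length_cons] at hl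
        omega
      · refine (hP.system.not_product i.castSucc (t.map Fin.castSucc) (by simpa using hi)).2 ?_
        rw [List.map_cons, List.prod_cons] at h
        have h' := congrArg (wordProd (P i.castSucc) * ·) h
        simp only [← mul_assoc, hsq, one_mul, mul_neg, mul_one] at h'
        rw [List.map_map]
        exact (neg_eq_iff_eq_neg.1 h'.symm)

theorem IsInvolutionSystem.isInvolutionGroup {k : ℕ} {P : Fin (k + 1) → List (Idx r s)}
    (hP : IsInvolutionSystem P) [Nontrivial (Cl r s)] : IsInvolutionGroup (systemGroup P) where
  one_mem := ⟨[], rfl⟩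
  mul_mem := by
    rintro _ ⟨l, rfl⟩ _ ⟨l', rfl⟩
    exact ⟨l ++ l', by simp⟩
  even_word := by
    rintro _ ⟨l, rfl⟩
    refine ⟨(l.map fun j => P j.castSucc).flatten, ?_, Or.inl ?_⟩
    · induction l with
      | nil => simp
      | cons i l ih =>
        simp only [List.map_cons, List.flatten_cons, List.length_append, hP.length_init]
        exact Even.add (by decide) ih
    · induction l with
      | nil => rfl
      | cons i l ih => simp [ih]
  star_eq := by
    rintro _ ⟨l, rfl⟩
    induction l with
    | nil => simp
    | cons i l ih =>
      simp only [List.map_cons, List.prod_cons, star_mul] at ih ⊢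
      rw [ih, star_wordProd_of_length_four (hP.system.basic _).1 (hP.length_init i)]
      refine (Commute.list_prod_right _ _ ?_).eq.symm
      simp only [List.mem_map]
      rintro _ ⟨j, -, rfl⟩
      exact hP.system.commute _ _
  neg_one_notMem := by
    rintro ⟨l, h⟩
    exact hP.prod_ne_neg_one _ l rfl h

end InvolutionGroups

/-! ### Admissible representations -/

section Representations

variable {r s : ℕ}
  {V : Type*} [AddCommGroup V] [Module ℝ V]
  {V' : Type*} [AddCommGroup V'] [Module ℝ V']

/-- An admissible module, as a representation of the Clifford algebra together with a bilinear
form. -/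
structure IsAdmissibleRep (ρ : Cl r s →ₐ[ℝ] Module.End ℝ V) (B : LinearMap.BilinForm ℝ V) :
    Prop where
  symm : ∀ x y, B x y = B y x
  nondegenerate : ∀ x, (∀ y, B x y = 0) → x = 0
  skew : ∀ (z : Vec r s) (x y : V), B (ρ (gen z) x) y + B x (ρ (gen z) y) = 0

theorem IsAdmissibleRep.adjoint {ρ : Cl r s →ₐ[ℝ] Module.End ℝ V} {B : LinearMap.BilinForm ℝ V}
    (h : IsAdmissibleRep ρ B) (a : Cl r s) (x y : V) : B (ρ a x) y = B x (ρ (star a) y) := by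
  induction a using CliffordAlgebra.induction generalizing x y with
  | algebraMap c => simp [CliffordAlgebra.star_algebraMap]
  | ι z =>
    have := h.skew z x y
    change B (ρ (gen z) x) y = B x (ρ (star (CliffordAlgebra.ι _ z)) y)
    rw [CliffordAlgebra.star_ι, map_neg, LinearMap.neg_apply, map_neg]
    exact eq_neg_of_add_eq_zero_left this
  | mul a b ha hb => simp only [map_mul, star_mul, Module.End.mul_apply, ha, hb]
  | add a b ha hb => simp only [map_add, star_add, LinearMap.add_apply, ha, hb]

/-- An even word containing `z_i` an odd number of times anticommutes with the invertible `z_i`,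
hence is conjugate to its negative. -/
theorem trace_eq_zero_of_odd_count (ρ : Cl r s →ₐ[ℝ] Module.End ℝ V) {w : List (Idx r s)}
    (hw : Even w.length) {i : Idx r s} (hi : Odd (w.count i)) :
    LinearMap.trace ℝ V (ρ (wordProd w)) = 0 := by
  have h := basisGen_mul_wordProd i w
  rw [(hw.add_odd hi).neg_one_pow, neg_one_mul] at h
  have h1 : LinearMap.trace ℝ V (ρ (basisGen i * (basisGen i * wordProd w))) =
      -LinearMap.trace ℝ V (ρ (basisGen i * (basisGen i * wordProd w))) := by
    conv_lhs => rw [h, mul_neg, ← mul_assoc, map_neg, map_neg, map_mul, LinearMap.trace_mul_comm,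
      ← map_mul]
  rw [← mul_assoc, basisGen_mul_self, map_mul, AlgHom.commutes, ← Algebra.smul_def, map_smul,
    smul_eq_mul] at h1
  rcases sgn_eq i with h2 | h2 <;> rw [h2] at h1 <;> linarith

namespace IsInvolutionGroup

variable {G : Set (Cl r s)}

theorem trace_eq_zero (hG : IsInvolutionGroup G) (ρ : Cl r s →ₐ[ℝ] Module.End ℝ V) {x : Cl r s}
    (hx : x ∈ G) (hx1 : x ≠ 1) : LinearMap.trace ℝ V (ρ x) = 0 := by
  obtain ⟨w, hw, hxw⟩ := hG.even_word x hx
  by_cases h : ∃ i, Odd (w.count i)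
  · obtain ⟨i, hi⟩ := h
    have := trace_eq_zero_of_odd_count ρ hw hi
    rcases hxw with rfl | rfl
    · exact this
    · simp [this]
  · push Not at h
    have h1 : EqUpToSign x 1 := hxw.trans (wordProd_parity (w' := []) fun i => by simpa using h i)
    rcases h1 with h1 | h1
    · exact absurd h1 hx1
    · exact absurd (h1 ▸ hx) hG.neg_one_notMem

/-- The sum of the elements of `G`: a multiple of the projection to the `G`-fixed vectors. -/
noncomputable def average (hG : IsInvolutionGroup G) (ρ : Cl r s →ₐ[ℝ] Module.End ℝ V) :
    Module.End ℝ V := ∑ g ∈ hG.finite.toFinset, ρ g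

theorem apply_average (hG : IsInvolutionGroup G) (ρ : Cl r s →ₐ[ℝ] Module.End ℝ V) {g : Cl r s}
    (hg : g ∈ G) (x : V) : ρ g (hG.average ρ x) = hG.average ρ x := by
  simp only [average, LinearMap.sum_apply, map_sum, ← Module.End.mul_apply, ← map_mul]
  refine Finset.sum_bij' (fun h _ => g * h) (fun h _ => g * h) ?_ ?_ ?_ ?_ ?_
  · intro h hh
    simpa using hG.mul_mem g hg h (by simpa using hh)
  · intro h hh
    simpa using hG.mul_mem g hg h (by simpa using hh)
  · intro h _
    simp only [← mul_assoc, hG.mul_self hg, one_mul]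
  · intro h _
    simp only [← mul_assoc, hG.mul_self hg, one_mul]
  · intro h _
    rfl

theorem trace_average (hG : IsInvolutionGroup G) (ρ : Cl r s →ₐ[ℝ] Module.End ℝ V) :
    LinearMap.trace ℝ V (hG.average ρ) = LinearMap.trace ℝ V 1 := by
  rw [average, map_sum, Finset.sum_eq_single 1, map_one]
  · exact fun g hg h1 => hG.trace_eq_zero ρ (by simpa using hg) h1
  · exact fun h => absurd (by simpa using hG.one_mem) h

/-- The average maps into the fixed vectors, and its trace is `dim V ≠ 0` because only the identity
of `G` contributes. -/
theorem exists_fixed (hG : IsInvolutionGroup G) (ρ : Cl r s →ₐ[ℝ] Module.End ℝ V)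
    [FiniteDimensional ℝ V] [Nontrivial V] : ∃ x : V, x ≠ 0 ∧ ∀ g ∈ G, ρ g x = x := by
  by_contra! hcon
  have h0 : hG.average ρ = 0 := by
    ext x
    by_contra hx
    obtain ⟨g, hg, hne⟩ := hcon _ hx
    exact hne (hG.apply_average ρ hg x)
  have h := hG.trace_average ρ
  rw [h0, map_zero, LinearMap.trace_one] at h
  exact Module.finrank_pos.ne' (by exact_mod_cast h.symm)

/-- Averaging a vector that pairs nontrivially with a fixed `u` gives a fixed `e` with `B u e ≠ 0`.
By polarization one of `u`, `e`, `u + e` is not isotropic. No positivity is required, so this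
applies to twisted modules. -/
theorem exists_fixed_form_ne_zero (hG : IsInvolutionGroup G)
    {ρ : Cl r s →ₐ[ℝ] Module.End ℝ V} {B : LinearMap.BilinForm ℝ V} (hB : IsAdmissibleRep ρ B)
    [FiniteDimensional ℝ V] [Nontrivial V] : ∃ x : V, B x x ≠ 0 ∧ ∀ g ∈ G, ρ g x = x := by
  obtain ⟨u, hu0, hu⟩ := hG.exists_fixed ρ
  obtain ⟨y, hy⟩ : ∃ y, B u y ≠ 0 := by
    by_contra! h
    exact hu0 (hB.nondegenerate u h)
  set e := hG.average ρ y with he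
  have hue : B u e ≠ 0 := by
    have : B u e = hG.finite.toFinset.card • B u y := by
      rw [he, average, LinearMap.sum_apply, map_sum, Finset.sum_congr rfl (g := fun _ => B u y),
        Finset.sum_const]
      intro g hg
      have hg' : g ∈ G := by simpa using hg
      rw [← hG.star_eq g hg', ← hB.adjoint, hu g hg']
    rw [this, nsmul_eq_mul]
    refine mul_ne_zero ?_ hy
    rw [Nat.cast_ne_zero, Finset.card_ne_zero]
    exact ⟨1, by simpa using hG.one_mem⟩
  have hfix : ∀ g ∈ G, ρ g e = e := fun g hg => hG.apply_average ρ hg y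
  by_contra! hcon
  have h1 : B u u = 0 := by
    by_contra h
    obtain ⟨g, hg, h⟩ := hcon u h
    exact h (hu g hg)
  have h2 : B e e = 0 := by
    by_contra h
    obtain ⟨g, hg, h⟩ := hcon e h
    exact h (hfix g hg)
  have h3 : B (u + e) (u + e) = 0 := by
    by_contra h
    obtain ⟨g, hg, h⟩ := hcon (u + e) h
    exact h (by rw [map_add, hu g hg, hfix g hg])
  simp only [map_add, LinearMap.add_apply, h1, h2, hB.symm e u] at h3
  apply hue
  linarith

end IsInvolutionGroup

/-! ### Cyclic modules determined by the functional `a ↦ B (a v) v`. -/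

section Comparison

variable {G : Set (Cl r s)}
  {ρ : Cl r s →ₐ[ℝ] Module.End ℝ V} {B : LinearMap.BilinForm ℝ V}
  {ρ' : Cl r s →ₐ[ℝ] Module.End ℝ V'} {B' : LinearMap.BilinForm ℝ V'}
  {v : V} {v' : V'}

theorem IsAdmissibleRep.form_word_eq_zero_of_star (hB : IsAdmissibleRep ρ B)
    {w : List (Idx r s)} (hw : star (wordProd w) = -wordProd w) (v : V) :
    B (ρ (wordProd w) v) v = 0 := by
  have h := hB.adjoint (wordProd w) v v
  rw [hw, map_neg, LinearMap.neg_apply, map_neg, hB.symm v] at h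
  linarith

theorem IsAdmissibleRep.form_word_eq_zero_of_anticommute (hB : IsAdmissibleRep ρ B)
    {g x : Cl r s} (hg : star g = g) (hgv : ρ g v = v) (h : g * x = -(x * g)) :
    B (ρ x v) v = 0 := by
  have h1 : B (ρ (g * x) v) v = B (ρ x v) v := by
    rw [map_mul, Module.End.mul_apply, hB.adjoint, hg, hgv]
  have h2 : B (ρ (g * x) v) v = -B (ρ x v) v := by
    rw [h, map_neg, map_mul, LinearMap.neg_apply, Module.End.mul_apply, hgv, map_neg,
      LinearMap.neg_apply]
  linarith

/-- Both sides vanish if the word is skew-adjoint or anticommutes with some element of `G`.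
Otherwise the word is self-adjoint and commutes with `G`. If its square is `1`, saturation puts it
in `±G`, where it acts by the same sign on `v` and `v'`. -/
theorem IsSaturated.form_even_word_eq (hG : IsSaturated G) (hB : IsAdmissibleRep ρ B)
    (hB' : IsAdmissibleRep ρ' B')
    (hpos : ∀ x, (∀ g ∈ G, ρ g x = x) → x ≠ 0 → 0 < B x x) (hv0 : v ≠ 0)
    (hv : ∀ g ∈ G, ρ g v = v) (hv' : ∀ g ∈ G, ρ' g v' = v') {w : List (Idx r s)}
    (hw : Even w.length) :
    B' v' v' * B (ρ (wordProd w) v) v = B v v * B' (ρ' (wordProd w) v') v' := by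
  rcases star_wordProd w with hstar | hstar
  swap
  · rw [hB.form_word_eq_zero_of_star hstar, hB'.form_word_eq_zero_of_star hstar]
    simp
  by_cases hcomm : ∀ g ∈ G, Commute g (wordProd w)
  swap
  · push Not at hcomm
    obtain ⟨g, hg, hgw⟩ := hcomm
    have hanti : g * wordProd w = -(wordProd w * g) := by
      obtain ⟨u, -, hu⟩ := hG.even_word g hg
      have : EqUpToSign (g * wordProd w) (wordProd w * g) :=
        (hu.mul (.refl _)).trans ((wordProd_comm u w).trans ((EqUpToSign.refl _).mul hu.symm))
      exact this.resolve_left hgw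
    rw [hB.form_word_eq_zero_of_anticommute (hG.star_eq g hg) (hv g hg) hanti,
      hB'.form_word_eq_zero_of_anticommute (hG.star_eq g hg) (hv' g hg) hanti]
    simp
  rcases wordProd_sq w with hsq | hsq
  · rcases hG.saturated w hw hstar hcomm hsq with h | h
    · rw [hv _ h, hv' _ h, mul_comm]
    · have h1 := hv _ h
      have h2 := hv' _ h
      rw [map_neg, LinearMap.neg_apply, neg_eq_iff_eq_neg] at h1 h2
      rw [h1, h2]
      simp only [map_neg, LinearMap.neg_apply]
      ring
  -- A self-adjoint word of square `-1` commuting with `G` would send `v` to a `G`-fixed vector of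
  -- norm `-B v v < 0`, against positivity.
  · exfalso
    have hvpos := hpos v hv hv0
    have h1 : B (ρ (wordProd w) v) (ρ (wordProd w) v) = -B v v := by
      rw [hB.adjoint, hstar, ← Module.End.mul_apply, ← map_mul, hsq]
      simp
    have h2 := hpos (ρ (wordProd w) v) (fun g hg => by
      rw [← Module.End.mul_apply, ← map_mul, (hcomm g hg).eq, map_mul, Module.End.mul_apply,
        hv g hg]) (fun h0 => by
      rw [h0] at h1
      simp at h1
      linarith)
    linarith

theorem IsSaturated.form_eq (hG : IsSaturated G) (hB : IsAdmissibleRep ρ B)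
    (hB' : IsAdmissibleRep ρ' B') (hodd : Odd (r + s)) {ε : ℝ} (hε : ε ≠ 0)
    (hΩ : ρ (volumeForm r s) = algebraMap ℝ _ ε) (hΩ' : ρ' (volumeForm r s) = algebraMap ℝ _ ε)
    (hpos : ∀ x, (∀ g ∈ G, ρ g x = x) → x ≠ 0 → 0 < B x x) (hv0 : v ≠ 0)
    (hv : ∀ g ∈ G, ρ g v = v) (hv' : ∀ g ∈ G, ρ' g v' = v') (a : Cl r s) :
    B' v' v' * B (ρ a v) v = B v v * B' (ρ' a v') v' := by
  have hword : ∀ w : List (Idx r s),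
      B' v' v' * B (ρ (wordProd w) v) v = B v v * B' (ρ' (wordProd w) v') v' := by
    intro w
    rcases Nat.even_or_odd w.length with hw | hw
    · exact hG.form_even_word_eq hB hB' hpos hv0 hv hv' hw
    -- Prefixing the volume word, of odd length `r + s`, makes an odd word even and only multiplies
    -- its action by the common scalar `ε`.
    · have h := hG.form_even_word_eq hB hB' hpos hv0 hv hv' (w := volumeWord r s ++ w) (by
        rw [List.length_append, length_volumeWord]
        exact hodd.add_odd hw)
      rw [wordProd_append, ← volumeForm_eq, map_mul, map_mul, hΩ, hΩ'] at h
      simp only [Module.End.mul_apply, Module.algebraMap_end_apply, map_smul, smul_eq_mul,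
        LinearMap.smul_apply] at h
      apply mul_left_cancel₀ hε
      linear_combination h
  have ha : a ∈ Submodule.span ℝ (Set.range (wordProd : List (Idx r s) → Cl r s)) :=
    span_words ▸ Submodule.mem_top
  induction ha using Submodule.span_induction with
  | mem x hx =>
    obtain ⟨w, rfl⟩ := hx
    exact hword w
  | zero => simp
  | add x y _ _ hx hy =>
    simp only [map_add, LinearMap.add_apply, mul_add, hx, hy]
  | smul c x _ hx =>
    simp only [map_smul, LinearMap.smul_apply, smul_eq_mul]
    linear_combination c * hx

/-- The orbit map `a ↦ a v`. -/
noncomputable def orbitMap (ρ : Cl r s →ₐ[ℝ] Module.End ℝ V) (v : V) : Cl r s →ₗ[ℝ] V :=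
  (LinearMap.applyₗ v).comp ρ.toLinearMap

@[simp] theorem orbitMap_apply (ρ : Cl r s →ₐ[ℝ] Module.End ℝ V) (v : V) (a : Cl r s) :
    orbitMap ρ v a = ρ a v := rfl

theorem IsAdmissibleRep.form_orbit (hB : IsAdmissibleRep ρ B) (a b : Cl r s) :
    B (ρ a v) (ρ b v) = B (ρ (star b * a) v) v := by
  rw [map_mul, Module.End.mul_apply, hB.adjoint (star b), star_star]

/-- If `a v' = 0`, the functional at `star b * a` gives `⟨a v, b v⟩ = 0` for every `b`. Since `v` is
cyclic, nondegeneracy yields `a v = 0`. -/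
theorem ker_orbitMap_le (hB : IsAdmissibleRep ρ B) (hB' : IsAdmissibleRep ρ' B')
    (h : ∀ a, B' v' v' * B (ρ a v) v = B v v * B' (ρ' a v') v') (hv' : B' v' v' ≠ 0)
    (hcyc : Function.Surjective (orbitMap ρ v)) :
    LinearMap.ker (orbitMap ρ' v') ≤ LinearMap.ker (orbitMap ρ v) := by
  intro a ha
  rw [LinearMap.mem_ker, orbitMap_apply] at ha ⊢
  refine hB.nondegenerate _ fun y => ?_
  obtain ⟨b, rfl⟩ := hcyc y
  have h1 := h (star b * a)
  rw [← hB.form_orbit, ← hB'.form_orbit, ha] at h1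
  simpa [hv'] using h1

/-- The kernel inclusion makes the cyclic module `V` a quotient of the orbit of `v'`. That orbit
therefore has full dimension. -/
theorem surjective_orbitMap_of_finrank_eq [FiniteDimensional ℝ V] [FiniteDimensional ℝ V']
    (hker : LinearMap.ker (orbitMap ρ' v') ≤ LinearMap.ker (orbitMap ρ v))
    (hcyc : Function.Surjective (orbitMap ρ v))
    (hdim : Module.finrank ℝ V' = Module.finrank ℝ V) :
    Function.Surjective (orbitMap ρ' v') := by
  rw [← LinearMap.range_eq_top]
  refine Submodule.eq_top_of_finrank_eq (le_antisymm (Submodule.finrank_le _) ?_)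
  have e' := (orbitMap ρ' v').quotKerEquivRange
  let f : (Cl r s ⧸ LinearMap.ker (orbitMap ρ' v')) →ₗ[ℝ] V :=
    (LinearMap.ker (orbitMap ρ' v')).liftQ (orbitMap ρ v) hker
  have hf : Function.Surjective (f ∘ₗ e'.symm.toLinearMap) := by
    intro x
    obtain ⟨a, rfl⟩ := hcyc x
    exact ⟨e' (Submodule.Quotient.mk a), by simp [f]⟩
  rw [hdim]
  exact LinearMap.finrank_le_finrank_of_surjective hf

theorem exists_equiv_of_form_eq (hB : IsAdmissibleRep ρ B) (hB' : IsAdmissibleRep ρ' B')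
    (h : ∀ a, B' v' v' * B (ρ a v) v = B v v * B' (ρ' a v') v') (hv : B v v ≠ 0)
    (hv' : B' v' v' ≠ 0) (hcyc : Function.Surjective (orbitMap ρ v))
    (hcyc' : Function.Surjective (orbitMap ρ' v')) :
    ∃ A : V ≃ₗ[ℝ] V', (∀ a x, A (ρ a x) = ρ' a (A x)) ∧
      ∀ x y, B' (A x) (A y) = B' v' v' / B v v * B x y := by
  have hker : LinearMap.ker (orbitMap ρ v) = LinearMap.ker (orbitMap ρ' v') :=
    le_antisymm (ker_orbitMap_le hB' hB (fun a => (h a).symm) hv hcyc')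
      (ker_orbitMap_le hB hB' h hv' hcyc)
  let A : V ≃ₗ[ℝ] V' := ((orbitMap ρ v).quotKerEquivOfSurjective hcyc).symm.trans
    ((Submodule.quotEquivOfEq _ _ hker).trans ((orbitMap ρ' v').quotKerEquivOfSurjective hcyc'))
  have hA : ∀ a, A (ρ a v) = ρ' a v' := by
    intro a
    have : ((orbitMap ρ v).quotKerEquivOfSurjective hcyc).symm (ρ a v) =
        Submodule.Quotient.mk a := by
      rw [LinearEquiv.symm_apply_eq]
      rfl
    simp only [A, LinearEquiv.trans_apply, this]
    rfl
  refine ⟨A, fun a x => ?_, fun x y => ?_⟩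
  · obtain ⟨b, rfl⟩ := hcyc x
    simp only [orbitMap_apply]
    rw [← Module.End.mul_apply, ← map_mul, hA, hA, map_mul, Module.End.mul_apply]
  · obtain ⟨a, rfl⟩ := hcyc x
    obtain ⟨b, rfl⟩ := hcyc y
    simp only [orbitMap_apply, hA]
    rw [hB.form_orbit, hB'.form_orbit, div_mul_eq_mul_div, eq_div_iff hv]
    linear_combination -h (star b * a)

end Comparison

end Representations

/-! ### Uniqueness of minimal admissible modules -/

section Uniqueness

variable {r s : ℕ}

/-- The representation of the Clifford algebra on a Clifford module. -/
noncomputable def rep (r s : ℕ) (V : Type*) [AddCommGroup V] [Module ℝ V] [Module (Cl r s) V]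
    [IsScalarTower ℝ (Cl r s) V] : Cl r s →ₐ[ℝ] Module.End ℝ V := Algebra.lsmul ℝ ℝ V

section

variable {V : Type*} [AddCommGroup V] [Module ℝ V] [Module (Cl r s) V]
  [IsScalarTower ℝ (Cl r s) V]

@[simp] theorem rep_apply (a : Cl r s) (x : V) : rep r s V a x = a • x := rfl

theorem AdmissibleForm.isAdmissibleRep (g : AdmissibleForm r s V) :
    IsAdmissibleRep (rep r s V) g.form where
  symm := g.symm
  nondegenerate := g.nondegenerate
  skew := g.skew

theorem AdmissibleForm.isAdmissibleRep_comp (g : AdmissibleForm r s V) (σ : Cl r s →ₐ[ℝ] Cl r s)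
    (hσ : ∀ z : Vec r s, ∃ z' : Vec r s, σ (gen z) = gen z') :
    IsAdmissibleRep ((rep r s V).comp σ) g.form where
  symm := g.symm
  nondegenerate := g.nondegenerate
  skew z x y := by
    obtain ⟨z', hz'⟩ := hσ z
    simpa [hz'] using g.skew z' x y

theorem AdmissibleForm.adjoint (g : AdmissibleForm r s V) (a : Cl r s) (x y : V) :
    g.form (a • x) y = g.form x (star a • y) := g.isAdmissibleRep.adjoint a x y

/-- The restriction of an admissible form to a submodule. -/
noncomputable def AdmissibleForm.restrict (g : AdmissibleForm r s V) (N : Submodule (Cl r s) V)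
    (hN : ∀ x ∈ N, (∀ y ∈ N, g.form x y = 0) → x = 0) : AdmissibleForm r s N where
  form := g.form.compl₁₂ (N.subtype.restrictScalars ℝ) (N.subtype.restrictScalars ℝ)
  symm _ _ := g.symm _ _
  nondegenerate x hx := Subtype.ext (hN x x.2 fun y hy => hx ⟨y, hy⟩)
  skew z _ _ := g.skew z _ _

theorem nontrivial_cl (V : Type*) [AddCommGroup V] [Module (Cl r s) V] [Nontrivial V] : Nontrivial (Cl r s) := by
  obtain ⟨x, hx⟩ := exists_ne (0 : V)
  refine ⟨1, 0, fun h => hx ?_⟩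
  rw [← one_smul (Cl r s) x, h, zero_smul]

variable {G : Set (Cl r s)} {g : AdmissibleForm r s V}

/-- A nonzero submodule contains a nonzero `G`-fixed vector, whose norm is positive. -/
theorem IsInvolutionGroup.eq_zero_of_isotropic (hG : IsInvolutionGroup G) [FiniteDimensional ℝ V]
    (hpos : ∀ x : V, (∀ h ∈ G, h • x = x) → x ≠ 0 → 0 < g.form x x)
    (R : Submodule (Cl r s) V) (hR : ∀ x ∈ R, g.form x x = 0) : R = ⊥ := by
  by_contra hne
  have : Nontrivial R := Submodule.nontrivial_iff_ne_bot.2 hne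
  have : FiniteDimensional ℝ R :=
    inferInstanceAs (FiniteDimensional ℝ (R.restrictScalars ℝ))
  obtain ⟨x, hx0, hx⟩ := hG.exists_fixed (rep r s R)
  have := hpos x (fun h hh => congrArg Subtype.val (hx h hh)) fun h => hx0 (Subtype.ext h)
  exact this.ne' (hR x x.2)

/-- The isotropic part of a submodule. -/
def AdmissibleForm.radical (g : AdmissibleForm r s V) (N : Submodule (Cl r s) V) :
    Submodule (Cl r s) V where
  carrier := {x | x ∈ N ∧ ∀ y ∈ N, g.form x y = 0}
  add_mem' hx hx' := ⟨N.add_mem hx.1 hx'.1, fun y hy => by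
    rw [map_add, LinearMap.add_apply, hx.2 y hy, hx'.2 y hy, add_zero]⟩
  zero_mem' := ⟨N.zero_mem, fun y _ => by simp⟩
  smul_mem' a x hx := ⟨N.smul_mem a hx.1, fun y hy => by
    rw [g.adjoint]
    exact hx.2 _ (N.smul_mem _ hy)⟩

/-- The radical of the form on the span of `v` is an isotropic submodule, hence zero. The span is
then admissible, and minimality of the dimension makes it everything. -/
theorem AdmissibleForm.IsMinimal.exists_smul_eq (hg : g.IsMinimal) (hG : IsInvolutionGroup G)
    (hpos : ∀ x : V, (∀ h ∈ G, h • x = x) → x ≠ 0 → 0 < g.form x x) {v : V} (hv : v ≠ 0)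
    (x : V) : ∃ a : Cl r s, a • v = x := by
  obtain ⟨-, hfin, hmin⟩ := hg
  set N := Submodule.span (Cl r s) {v} with hN
  have hvN : v ∈ N := Submodule.mem_span_singleton_self v
  have hrad : g.radical N = ⊥ :=
    hG.eq_zero_of_isotropic hpos _ fun x hx => hx.2 x hx.1
  have hnon : Nontrivial N := ⟨⟨v, hvN⟩, 0, fun h => hv (congrArg Subtype.val h)⟩
  have hfinN : FiniteDimensional ℝ N :=
    inferInstanceAs (FiniteDimensional ℝ (N.restrictScalars ℝ))
  have hle := hmin N (g.restrict N fun x hx h => by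
    have : x ∈ g.radical N := ⟨hx, h⟩
    rwa [hrad, Submodule.mem_bot] at this) hnon hfinN
  have htop : N.restrictScalars ℝ = ⊤ :=
    Submodule.eq_top_of_finrank_eq (le_antisymm (Submodule.finrank_le _) hle)
  have hx : x ∈ N.restrictScalars ℝ := htop ▸ Submodule.mem_top
  exact Submodule.mem_span_singleton.1 hx

end

theorem involute_wordProd (w : List (Idx r s)) :
    CliffordAlgebra.involute (wordProd w) = (-1) ^ w.length * wordProd w := by
  induction w with
  | nil => simp
  | cons i w ih =>
    have hi : CliffordAlgebra.involute (basisGen i : Cl r s) = -basisGen i :=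
      CliffordAlgebra.involute_ι _
    rw [wordProd_cons, map_mul, hi, ih, List.length_cons, pow_succ', neg_one_mul, neg_mul, neg_mul,
      ← mul_assoc, ← mul_assoc]
    congr 2
    exact (Commute.neg_one_right (basisGen i : Cl r s)).pow_right _

theorem IsInvolutionGroup.involute_eq {G : Set (Cl r s)} (hG : IsInvolutionGroup G) {x : Cl r s}
    (hx : x ∈ G) : CliffordAlgebra.involute x = x := by
  obtain ⟨w, hw, rfl | rfl⟩ := hG.even_word x hx <;> simp [involute_wordProd, hw.neg_one_pow]

section

variable {Vp : Type*} [AddCommGroup Vp] [Module ℝ Vp] [Module (Cl r s) Vp]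
  [IsScalarTower ℝ (Cl r s) Vp] {gp : AdmissibleForm r s Vp}
  {k : ℕ} {P : Fin (k + 1) → List (Idx r s)}

theorem mem_commonEigenspace_of_fixed {V : Type*} [AddCommGroup V] [Module (Cl r s) V]
    {G : Set (Cl r s)} (hPG : systemGroup P ⊆ G) {x : V}
    (hx : ∀ h ∈ G, h • x = x) : x ∈ commonEigenspace P V :=
  fun i => hx _ (hPG ⟨[i], by simp⟩)

/-- A minimal admissible module with trivial action of the volume form is isomorphic, up to scaling
the form, to the module twisted by an automorphism of the Clifford algebra for which the volume form
still acts trivially. -/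
theorem exists_twisted_automorphism (hodd : Odd (r + s)) (hP : IsInvolutionSystem P)
    (hgp : gp.IsMinimal) (hΩp : ∀ v : Vp, volumeForm r s • v = v)
    (hEp : ∀ v ∈ commonEigenspace P Vp, v ≠ 0 → 0 < gp.form v v) (σ : Cl r s →ₐ[ℝ] Cl r s)
    (hσ : ∀ z : Vec r s, ∃ z' : Vec r s, σ (gen z) = gen z')
    (hΩσ : ∀ v : Vp, σ (volumeForm r s) • v = v) :
    ∃ (A : Vp ≃ₗ[ℝ] Vp) (c : ℝ), c ≠ 0 ∧ (∀ (a : Cl r s) x, A (a • x) = σ a • A x) ∧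
      ∀ x y, gp.form (A x) (A y) = c * gp.form x y := by
  have hnon := hgp.1
  have hfin := hgp.2.1
  have := nontrivial_cl (r := r) (s := s) Vp
  obtain ⟨G, hPG, hG⟩ := hP.isInvolutionGroup.exists_isSaturated
  have hpos : ∀ x : Vp, (∀ h ∈ G, h • x = x) → x ≠ 0 → 0 < gp.form x x := fun x hx =>
    hEp x (mem_commonEigenspace_of_fixed hPG hx)
  obtain ⟨v, hv0, hv⟩ := hG.exists_fixed (rep r s Vp)
  have hB' := gp.isAdmissibleRep_comp σ hσ
  obtain ⟨v', hv'0, hv'⟩ := hG.exists_fixed_form_ne_zero hB'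
  have hvv : gp.form v v ≠ 0 := (hpos v hv hv0).ne'
  have hform := hG.form_eq gp.isAdmissibleRep hB' hodd (one_ne_zero (α := ℝ))
    (by ext x; simp [hΩp]) (by ext x; simp [hΩσ]) hpos hv0 hv hv'
  have hcyc : Function.Surjective (orbitMap (rep r s Vp) v) :=
    hgp.exists_smul_eq hG.toIsInvolutionGroup hpos hv0
  have hcyc' := surjective_orbitMap_of_finrank_eq
    (ker_orbitMap_le gp.isAdmissibleRep hB' hform hv'0 hcyc) hcyc rfl
  obtain ⟨A, hA, hA'⟩ := exists_equiv_of_form_eq gp.isAdmissibleRep hB' hform hvv hv'0 hcyc hcyc'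
  exact ⟨A, _, div_ne_zero hv'0 hvv, hA, hA'⟩

variable {Vm : Type*} [AddCommGroup Vm] [Module ℝ Vm] [Module (Cl r s) Vm]
  [IsScalarTower ℝ (Cl r s) Vm] {gm : AdmissibleForm r s Vm}

/-- The two minimal admissible modules are isometric up to changing the sign of the action. -/
theorem exists_antilinear_isometry (hodd : Odd (r + s)) (hP : IsInvolutionSystem P)
    (hgp : gp.IsMinimal) (hΩp : ∀ v : Vp, volumeForm r s • v = v)
    (hEp : ∀ v ∈ commonEigenspace P Vp, v ≠ 0 → 0 < gp.form v v)
    (hgm : gm.IsMinimal) (hΩm : ∀ v : Vm, volumeForm r s • v = -v)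
    (hEm : ∀ v ∈ commonEigenspace P Vm, v ≠ 0 → 0 < gm.form v v) :
    ∃ A : Vp ≃ₗ[ℝ] Vm, (∀ (i : Idx r s) x, A ((basisGen i : Cl r s) • x) =
      -((basisGen i : Cl r s) • A x)) ∧ ∀ x y, gm.form (A x) (A y) = gp.form x y := by
  have hnon := hgp.1
  have hfin := hgp.2.1
  have hnon' := hgm.1
  have hfin' := hgm.2.1
  have := nontrivial_cl (r := r) (s := s) Vp
  obtain ⟨G, hPG, hG⟩ := hP.isInvolutionGroup.exists_isSaturated
  have hpos : ∀ x : Vp, (∀ h ∈ G, h • x = x) → x ≠ 0 → 0 < gp.form x x := fun x hx =>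
    hEp x (mem_commonEigenspace_of_fixed hPG hx)
  have hpos' : ∀ x : Vm, (∀ h ∈ G, h • x = x) → x ≠ 0 → 0 < gm.form x x := fun x hx =>
    hEm x (mem_commonEigenspace_of_fixed hPG hx)
  obtain ⟨v, hv0, hv⟩ := hG.exists_fixed (rep r s Vp)
  obtain ⟨v', hv'0, hv'⟩ := hG.exists_fixed (rep r s Vm)
  have hB' := gm.isAdmissibleRep_comp CliffordAlgebra.involute fun z =>
    ⟨-z, by rw [map_neg]; exact CliffordAlgebra.involute_ι _⟩
  have hvv : 0 < gp.form v v := hpos v hv hv0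
  have hvv' : 0 < gm.form v' v' := hpos' v' hv' hv'0
  have hform := hG.form_eq gp.isAdmissibleRep hB' hodd (one_ne_zero (α := ℝ))
    (by ext x; simp [hΩp])
    -- The involution multiplies Ω by `(-1)^(r + s) = -1`, which cancels its action by `-1` on `Vm`.
    (by
      ext x
      simp [volumeForm_eq, involute_wordProd, length_volumeWord, hodd.neg_one_pow]
      simp [← volumeForm_eq, hΩm])
    hpos hv0 hv (v' := v') (fun g hg => by
      simpa [hG.involute_eq hg] using hv' g hg)
  have hcyc : Function.Surjective (orbitMap (rep r s Vp) v) :=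
    hgp.exists_smul_eq hG.toIsInvolutionGroup hpos hv0
  have hcyc' : Function.Surjective
      (orbitMap ((rep r s Vm).comp CliffordAlgebra.involute) v') := fun x => by
    obtain ⟨a, ha⟩ := hgm.exists_smul_eq hG.toIsInvolutionGroup hpos' hv'0 x
    exact ⟨CliffordAlgebra.involute a, by simpa using ha⟩
  obtain ⟨A, hA, hA'⟩ :=
    exists_equiv_of_form_eq gp.isAdmissibleRep hB' hform hvv.ne' hvv'.ne' hcyc hcyc'
  -- Positivity on both eigenspaces makes `c` positive, so rescaling by `1 / √c` gives an isometry.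
  set c := gm.form v' v' / gp.form v v with hc
  have hcpos : 0 < c := div_pos hvv' hvv
  have hc0 : (√c)⁻¹ ≠ 0 := inv_ne_zero (Real.sqrt_pos.2 hcpos).ne'
  refine ⟨A.trans (LinearEquiv.smulOfNeZero ℝ Vm _ hc0), fun i x => ?_, fun x y => ?_⟩
  · have hi : CliffordAlgebra.involute (basisGen i : Cl r s) = -basisGen i :=
      CliffordAlgebra.involute_ι _
    have := hA (basisGen i) x
    simp only [rep_apply, AlgHom.comp_apply, hi, neg_smul] at this
    simp only [LinearEquiv.trans_apply, this, LinearEquiv.smulOfNeZero_apply, smul_neg]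
    rw [smul_comm]
  · simp only [LinearEquiv.trans_apply, LinearEquiv.smulOfNeZero_apply, map_smul,
      LinearMap.smul_apply, hA', smul_eq_mul]
    have h2 : √c * √c = c := Real.mul_self_sqrt hcpos.le
    rw [← mul_assoc, ← mul_assoc, ← mul_inv, h2, inv_mul_cancel₀ hcpos.ne', one_mul]

end

end Uniqueness

/-! ### Isomorphisms of pseudo `H`-type Lie algebras -/

section LieIsomorphisms

set_option linter.unusedSectionVars false

open HTypeAlgebra

variable {r s : ℕ}
  {U : Type*} [AddCommGroup U] [Module ℝ U] [Module (Cl r s) U] [IsScalarTower ℝ (Cl r s) U]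
  {U' : Type*} [AddCommGroup U'] [Module ℝ U'] [Module (Cl r s) U'] [IsScalarTower ℝ (Cl r s) U']
  {g : AdmissibleForm r s U} {g' : AdmissibleForm r s U'}

theorem nonempty_lieEquiv_of_bracket (A : U ≃ₗ[ℝ] U') (C : Vec r s ≃ₗ[ℝ] Vec r s)
    (h : ∀ x y, bracket g' (A x) (A y) = C (bracket g x y)) :
    Nonempty (HTypeAlgebra g ≃ₗ⁅ℝ⁆ HTypeAlgebra g') := by
  let e : HTypeAlgebra g ≃ₗ[ℝ] HTypeAlgebra g' :=
    (A.prodCongr C : (U × Vec r s) ≃ₗ[ℝ] (U' × Vec r s))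
  refine ⟨{ e with map_lie' := ?_ }⟩
  intro a b
  exact Prod.ext (map_zero A) (h a.1 b.1).symm

/-- Nondegeneracy gives `J_z u = 0` for a basis vector `z`, and `J_z` is invertible. Thus `ℝ^{r,s}`
is the whole center and every isomorphism preserves it. -/
theorem eq_zero_of_bracket_eq_zero (hrs : 0 < r + s) {u : U} (hu : ∀ y, bracket g u y = 0) :
    u = 0 := by
  obtain ⟨i⟩ : Nonempty (Idx r s) := by
    rw [← Fintype.card_pos_iff]
    simpa using hrs
  have h1 : (basisGen i : Cl r s) • u = 0 := g.nondegenerate _ fun y => by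
    have := congrFun (hu y) i
    simp only [bracket, Pi.zero_apply, mul_eq_zero] at this
    refine this.resolve_left fun h => ?_
    have := sgn_mul_self i
    rw [h] at this
    simp at this
  have h2 : (basisGen i * basisGen i : Cl r s) • u = 0 := by rw [mul_smul, h1, smul_zero]
  rw [basisGen_mul_self, algebraMap_smul] at h2
  refine (smul_eq_zero.1 h2).resolve_left fun h => ?_
  have := sgn_mul_self i
  rw [neg_eq_zero.1 h] at this
  simp at this

theorem lieEquiv_center (hrs : 0 < r + s) (Φ : HTypeAlgebra g ≃ₗ⁅ℝ⁆ HTypeAlgebra g')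
    {a : HTypeAlgebra g} (ha : a.1 = 0) : (Φ a).1 = 0 := by
  refine eq_zero_of_bracket_eq_zero hrs (g := g') fun y => ?_
  have h : ∀ b : HTypeAlgebra g', ⁅Φ a, b⁆ = 0 := fun b => by
    obtain ⟨b, rfl⟩ := Φ.surjective b
    have hab : ⁅a, b⁆ = 0 := by
      rw [lie_def, ha, bracket_zero_left]
      rfl
    have := LieEquiv.map_lie Φ a b
    rw [hab] at this
    exact this.symm.trans (map_zero Φ.toLinearEquiv)
  exact congrArg Prod.snd (h (y, 0))

/-- `C` is the restriction to the center and `A` the induced map on the quotient by it. Central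
components of the images do not affect brackets. -/
theorem exists_bracket_of_lieEquiv (hrs : 0 < r + s)
    (Φ : HTypeAlgebra g ≃ₗ⁅ℝ⁆ HTypeAlgebra g') :
    ∃ (A : U ≃ₗ[ℝ] U') (C : Vec r s ≃ₗ[ℝ] Vec r s),
      ∀ x y, bracket g' (A x) (A y) = C (bracket g x y) := by
  let f : (U × Vec r s) ≃ₗ[ℝ] (U' × Vec r s) := Φ.toLinearEquiv
  have hf : ∀ z, f (0, z) = (0, (f (0, z)).2) := fun z =>
    Prod.ext (lieEquiv_center hrs Φ (a := (0, z)) rfl) rfl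
  have hf' : ∀ z, f.symm (0, z) = (0, (f.symm (0, z)).2) := fun z =>
    Prod.ext (lieEquiv_center hrs Φ.symm (a := (0, z)) rfl) rfl
  let A : U ≃ₗ[ℝ] U' := LinearEquiv.ofLinearMap
    (LinearMap.fst ℝ U' (Vec r s) ∘ₗ f.toLinearMap ∘ₗ LinearMap.inl ℝ U (Vec r s))
    (LinearMap.fst ℝ U (Vec r s) ∘ₗ f.symm.toLinearMap ∘ₗ LinearMap.inl ℝ U' (Vec r s))
    (by
      ext x
      change (f ((f.symm (x, 0)).1, 0)).1 = x
      have h : ((f.symm (x, 0)).1, (0 : Vec r s)) = f.symm (x, 0) - (0, (f.symm (x, 0)).2) := by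
        simp [Prod.ext_iff]
      rw [h, map_sub, f.apply_symm_apply, hf]
      simp)
    (by
      ext x
      change (f.symm ((f (x, 0)).1, 0)).1 = x
      have h : ((f (x, 0)).1, (0 : Vec r s)) = f (x, 0) - (0, (f (x, 0)).2) := by
        simp [Prod.ext_iff]
      rw [h, map_sub, f.symm_apply_apply, hf']
      simp)
  let C : Vec r s ≃ₗ[ℝ] Vec r s := LinearEquiv.ofLinearMap
    (LinearMap.snd ℝ U' (Vec r s) ∘ₗ f.toLinearMap ∘ₗ LinearMap.inr ℝ U (Vec r s))
    (LinearMap.snd ℝ U (Vec r s) ∘ₗ f.symm.toLinearMap ∘ₗ LinearMap.inr ℝ U' (Vec r s))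
    (by
      refine LinearMap.ext fun z => ?_
      change (f (0, (f.symm (0, z)).2)).2 = z
      rw [← hf', f.apply_symm_apply])
    (by
      refine LinearMap.ext fun z => ?_
      change (f.symm (0, (f (0, z)).2)).2 = z
      rw [← hf, f.symm_apply_apply])
  refine ⟨A, C, fun x y => ?_⟩
  have h := LieEquiv.map_lie Φ (show HTypeAlgebra g from (x, 0)) (show HTypeAlgebra g from (y, 0))
  exact (congrArg Prod.snd h).symm

theorem AdmissibleForm.prod_apply (g : AdmissibleForm r s U) (h : AdmissibleForm r s U')
    (x y : U × U') : (g.prod h).form x y = g.form x.1 y.1 + h.form x.2 y.2 := rfl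

theorem AdmissibleForm.copies_apply (g : AdmissibleForm r s U) (n : ℕ) (x y : Fin n → U) :
    (g.copies n).form x y = ∑ i, g.form (x i) (y i) := rfl

theorem AdmissibleForm.neg_apply (g : AdmissibleForm r s U) (x y : U) :
    g.neg.form x y = -g.form x y := rfl

/-! ### Reduction to `p` copies of one minimal module and `q` copies of its negative. -/

section Standard

variable {Vp : Type*} [AddCommGroup Vp] [Module ℝ Vp] [Module (Cl r s) Vp]
  [IsScalarTower ℝ (Cl r s) Vp]

/-- The orthogonal sum of `p` copies of an admissible module and `q` copies of its negative. -/
noncomputable def AdmissibleForm.signedCopies (gp : AdmissibleForm r s Vp) (p q : ℕ) :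
    AdmissibleForm r s ((Fin p → Vp) × (Fin q → Vp)) :=
  (gp.copies p).prod (gp.neg.copies q)

theorem AdmissibleForm.signedCopies_apply (gp : AdmissibleForm r s Vp) (p q : ℕ)
    (x y : (Fin p → Vp) × (Fin q → Vp)) : (gp.signedCopies p q).form x y =
      ∑ i, gp.form (x.1 i) (y.1 i) - ∑ j, gp.form (x.2 j) (y.2 j) := by
  rw [signedCopies, prod_apply, copies_apply, copies_apply, sub_eq_add_neg,
    ← Finset.sum_neg_distrib]
  rfl

theorem nonempty_lieEquiv_signedCopies_swap (gp : AdmissibleForm r s Vp) (p q : ℕ) :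
    Nonempty (HTypeAlgebra (gp.signedCopies p q) ≃ₗ⁅ℝ⁆ HTypeAlgebra (gp.signedCopies q p)) := by
  refine nonempty_lieEquiv_of_bracket (LinearEquiv.prodComm ℝ _ _) (LinearEquiv.neg ℝ) ?_
  intro x y
  ext i
  simp only [bracket, AdmissibleForm.signedCopies_apply, LinearEquiv.prodComm_apply,
    LinearEquiv.neg_apply, Pi.neg_apply, Prod.fst_swap, Prod.snd_swap, Prod.smul_fst,
    Prod.smul_snd]
  ring

variable {Vm : Type*} [AddCommGroup Vm] [Module ℝ Vm] [Module (Cl r s) Vm]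
  [IsScalarTower ℝ (Cl r s) Vm]

/-- The summands of a sum of four families of copies, grouped by the sign of the bracket. -/
def regroup (A : Vp ≃ₗ[ℝ] Vm) (ppp pmp ppm pmm : ℕ) :
    ((Fin (ppp + pmm) → Vp) × (Fin (pmp + ppm) → Vp)) →ₗ[ℝ]
      ((Fin ppp → Vp) × (Fin pmp → Vp) × (Fin ppm → Vm) × (Fin pmm → Vm)) where
  toFun x := (fun i => x.1 (Fin.castAdd pmm i), fun i => x.2 (Fin.castAdd ppm i),
    fun i => A (x.2 (Fin.natAdd pmp i)), fun i => A (x.1 (Fin.natAdd ppp i)))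
  map_add' x y := by ext <;> simp
  map_smul' c x := by ext <;> simp

theorem regroup_bijective (A : Vp ≃ₗ[ℝ] Vm) (ppp pmp ppm pmm : ℕ) :
    Function.Bijective (regroup A ppp pmp ppm pmm) := by
  constructor
  · rw [← LinearMap.ker_eq_bot, LinearMap.ker_eq_bot']
    intro x hx
    simp only [regroup, LinearMap.coe_mk, AddHom.coe_mk, Prod.mk_eq_zero, funext_iff,
      Pi.zero_apply, LinearEquiv.map_eq_zero_iff] at hx
    obtain ⟨h1, h2, h3, h4⟩ := hx
    refine Prod.ext (funext fun i => ?_) (funext fun i => ?_)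
    · exact Fin.addCases (motive := fun i => x.1 i = 0) h1 h4 i
    · exact Fin.addCases (motive := fun i => x.2 i = 0) h2 h3 i
  · rintro ⟨a, b, c, d⟩
    refine ⟨(Fin.append a fun i => A.symm (d i), Fin.append b fun i => A.symm (c i)), ?_⟩
    simp [regroup]

/-- `A` keeps the form but reverses `J_z`, so it reverses the bracket. For brackets, a copy of `gm`
counts as one of `gp.neg`, and a copy of `gm.neg` as one of `gp`. -/
theorem bracket_regroup {gp : AdmissibleForm r s Vp} {gm : AdmissibleForm r s Vm}
    (A : Vp ≃ₗ[ℝ] Vm)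
    (hA : ∀ (i : Idx r s) x, A ((basisGen i : Cl r s) • x) = -((basisGen i : Cl r s) • A x))
    (hA' : ∀ x y, gm.form (A x) (A y) = gp.form x y) (ppp pmp ppm pmm : ℕ)
    (x y : (Fin (ppp + pmm) → Vp) × (Fin (pmp + ppm) → Vp)) :
    bracket ((gp.copies ppp).prod ((gp.neg.copies pmp).prod
      ((gm.copies ppm).prod (gm.neg.copies pmm)))) (regroup A ppp pmp ppm pmm x)
      (regroup A ppp pmp ppm pmm y) =
      bracket (gp.signedCopies (ppp + pmm) (pmp + ppm)) x y := by
  have hA2 : ∀ (i : Idx r s) x y, gm.form ((basisGen i : Cl r s) • A x) (A y) =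
      -gp.form ((basisGen i : Cl r s) • x) y := by
    intro i x y
    rw [← hA', hA, map_neg, LinearMap.neg_apply, neg_neg]
  ext i
  rw [bracket, bracket, AdmissibleForm.signedCopies_apply]
  simp only [AdmissibleForm.prod_apply, AdmissibleForm.copies_apply, AdmissibleForm.neg_apply,
    regroup, LinearMap.coe_mk, AddHom.coe_mk, Prod.smul_fst, Prod.smul_snd, Pi.smul_apply,
    Fin.sum_univ_add, hA2, Finset.sum_neg_distrib, neg_neg]
  ring

theorem nonempty_lieEquiv_of_isometry {gp : AdmissibleForm r s Vp} {gm : AdmissibleForm r s Vm}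
    (A : Vp ≃ₗ[ℝ] Vm)
    (hA : ∀ (i : Idx r s) x, A ((basisGen i : Cl r s) • x) = -((basisGen i : Cl r s) • A x))
    (hA' : ∀ x y, gm.form (A x) (A y) = gp.form x y) (ppp pmp ppm pmm : ℕ)
    (hU : g.Iso ((gp.copies ppp).prod ((gp.neg.copies pmp).prod
      ((gm.copies ppm).prod (gm.neg.copies pmm))))) :
    Nonempty (HTypeAlgebra (gp.signedCopies (ppp + pmm) (pmp + ppm)) ≃ₗ⁅ℝ⁆ HTypeAlgebra g) := by
  obtain ⟨e, he⟩ := hU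
  refine nonempty_lieEquiv_of_bracket
    ((LinearEquiv.ofBijective _ (regroup_bijective A ppp pmp ppm pmm)).trans
      (e.symm.restrictScalars ℝ)) (LinearEquiv.refl ℝ _) ?_
  intro x y
  rw [LinearEquiv.refl_apply, ← bracket_regroup A hA hA']
  ext i
  simp only [bracket, ← he, LinearEquiv.trans_apply, LinearEquiv.restrictScalars_apply, map_smul,
    LinearEquiv.apply_symm_apply, LinearEquiv.ofBijective_apply]

end Standard

end LieIsomorphisms

/-! ### The induced map on the center -/

section QuadraticForms

variable {r s : ℕ}

/-- If `q₁ u ≠ 0` and `q₂ w ≠ 0`, then on the line `u + t w` the product vanishes only if one of two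
affine functions of `t` does, for `t ≠ 0`. Among `t = 1, 2, 3` one of them has two zeros, hence is
identically zero, a contradiction. -/
theorem quadraticForm_eq_zero_or_eq_zero {M : Type*} [AddCommGroup M] [Module ℝ M]
    (q₁ q₂ : QuadraticForm ℝ M) (h : ∀ z, q₁ z * q₂ z = 0) : (∀ z, q₁ z = 0) ∨ ∀ z, q₂ z = 0 := by
  by_contra! hcon
  obtain ⟨⟨u, hu⟩, w, hw⟩ := hcon
  have hu' : q₂ u = 0 := (mul_eq_zero.1 (h u)).resolve_left hu
  have hw' : q₁ w = 0 := (mul_eq_zero.1 (h w)).resolve_right hw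
  have key : ∀ t : ℝ, t ≠ 0 → q₁ u + t * QuadraticMap.polar q₁ u w = 0 ∨
      QuadraticMap.polar q₂ u w + t * q₂ w = 0 := by
    intro t ht
    have h1 := h (u + t • w)
    rw [QuadraticMap.map_add (⇑q₁), QuadraticMap.map_add (⇑q₂), QuadraticMap.map_smul, QuadraticMap.map_smul,
      QuadraticMap.polar_smul_right, QuadraticMap.polar_smul_right, hu', hw'] at h1
    simp only [smul_eq_mul, mul_zero, add_zero, zero_add] at h1
    rcases mul_eq_zero.1 h1 with h2 | h2
    · exact Or.inl h2
    · right
      apply mul_left_cancel₀ ht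
      linarith
  have k1 := key 1 one_ne_zero
  have k2 := key 2 two_ne_zero
  have k3 := key 3 three_ne_zero
  rcases k1 with k1 | k1 <;> rcases k2 with k2 | k2 <;> rcases k3 with k3 | k3 <;>
    first | exact hu (by linarith) | exact hw (by linarith)

theorem scalarProd_single_single (i j : Idx r s) :
    scalarProd (Pi.single i 1 : Vec r s) (Pi.single j 1) = Matrix.diagonal (sgn r s) i j := by
  rw [scalarProd, Finset.sum_eq_single i]
  · rcases eq_or_ne i j with rfl | h
    · simp
    · simp [h]
  · intro l _ hl
    simp [hl]
  · simp

/-- In matrices `Mᵀ S M = c S` with `S` the invertible Gram matrix; take determinants. -/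
theorem det_sq_of_quadForm_comp (D : Vec r s →ₗ[ℝ] Vec r s) (c : ℝ)
    (h : ∀ z, quadForm r s (D z) = c * quadForm r s z) :
    (LinearMap.toMatrix' D).det ^ 2 = c ^ (r + s) := by
  have hsp : ∀ z w, scalarProd (D z) (D w) = c * scalarProd z w := by
    intro z w
    have h1 := h (z + w)
    rw [map_add, quadForm_add, quadForm_add, h, h] at h1
    linarith
  set M := LinearMap.toMatrix' D with hM
  have hmat : M.transpose * Matrix.diagonal (sgn r s) * M = c • Matrix.diagonal (sgn r s) := by
    ext i j
    rw [Matrix.smul_apply, smul_eq_mul, ← scalarProd_single_single, ← hsp, scalarProd,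
      Matrix.mul_apply]
    refine Finset.sum_congr rfl fun l _ => ?_
    rw [Matrix.mul_diagonal, Matrix.transpose_apply, hM, LinearMap.toMatrix'_apply,
      LinearMap.toMatrix'_apply]
    ring
  have hdet := congrArg Matrix.det hmat
  rw [Matrix.det_mul, Matrix.det_mul, Matrix.det_transpose, Matrix.det_smul,
    Matrix.det_diagonal] at hdet
  have h0 : ∏ i, sgn r s i ≠ 0 := Finset.prod_ne_zero_iff.2 fun i _ => by
    rcases sgn_eq i with h | h <;> simp [h]
  apply mul_right_cancel₀ h0
  rw [Fintype.card_sum, Fintype.card_fin, Fintype.card_fin] at hdet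
  linear_combination hdet

/-- The product of the forms `Q ∘ D - c Q` and `Q ∘ D + c Q` vanishes, so one of them does. In the
second case `(det D)² = (-c)^(r + s)`, which is negative in odd dimension. -/
theorem quadForm_comp_eq_of_abs (hodd : Odd (r + s)) (D : Vec r s →ₗ[ℝ] Vec r s) {c : ℝ}
    (hc : 0 < c) (h : ∀ z, |quadForm r s (D z)| = c * |quadForm r s z|) (z : Vec r s) :
    quadForm r s (D z) = c * quadForm r s z := by
  rcases quadraticForm_eq_zero_or_eq_zero ((quadForm r s).comp D - c • quadForm r s)
    ((quadForm r s).comp D + c • quadForm r s) (fun z => by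
      have h1 : quadForm r s (D z) ^ 2 = (c * quadForm r s z) ^ 2 := by
        rw [← sq_abs, h, mul_pow, sq_abs, mul_pow]
      simp only [sub_apply, add_apply, smul_apply,
        QuadraticMap.comp_apply, smul_eq_mul]
      linear_combination h1) with h1 | h1
  · have := h1 z
    simp only [sub_apply, smul_apply, QuadraticMap.comp_apply,
      smul_eq_mul] at this
    linarith
  · exfalso
    have h2 := det_sq_of_quadForm_comp D (-c) fun z => by
      have := h1 z
      simp only [add_apply, smul_apply, QuadraticMap.comp_apply,
        smul_eq_mul] at this
      linarith
    have h3 : (-c) ^ (r + s) < 0 := hodd.pow_neg (by linarith)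
    have h4 := sq_nonneg (LinearMap.toMatrix' D).det
    linarith

theorem scalarProd_single (z : Vec r s) (i : Idx r s) :
    scalarProd z (Pi.single i 1) = sgn r s i * z i := by
  rw [scalarProd, Finset.sum_eq_single i]
  · simp
  · intro j _ hj
    simp [hj]
  · simp

theorem exists_scalarProd_adjoint (C : Vec r s ≃ₗ[ℝ] Vec r s) : ∃ D : Vec r s ≃ₗ[ℝ] Vec r s,
    ∀ z w, scalarProd (D z) w = scalarProd z (C w) := by
  let D : Vec r s →ₗ[ℝ] Vec r s :=
    { toFun z i := sgn r s i * scalarProd z (C (Pi.single i 1))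
      map_add' z z' := by
        ext i
        simp only [scalarProd, Pi.add_apply, ← mul_add, ← Finset.sum_add_distrib, add_mul]
      map_smul' c z := by
        ext i
        simp only [scalarProd, Pi.smul_apply, smul_eq_mul, RingHom.id_apply, Finset.mul_sum]
        exact Finset.sum_congr rfl fun j _ => by ring }
  have hD : ∀ z w, scalarProd (D z) w = scalarProd z (C w) := by
    intro z w
    have hw : w = ∑ i, w i • (Pi.single i 1 : Vec r s) := by
      ext j
      simp [Finset.sum_apply, Pi.single_apply]
    have h1 : scalarProd z (C w) = ∑ i, w i * scalarProd z (C (Pi.single i 1)) := by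
      conv_lhs => rw [hw]
      simp only [map_sum, map_smul, scalarProd, Finset.sum_apply, Pi.smul_apply, smul_eq_mul,
        Finset.mul_sum]
      rw [Finset.sum_comm]
      exact Finset.sum_congr rfl fun i _ => Finset.sum_congr rfl fun j _ => by ring
    rw [h1, scalarProd]
    refine Finset.sum_congr rfl fun i _ => ?_
    change sgn r s i * (sgn r s i * scalarProd z (C (Pi.single i 1)) * w i) = _
    linear_combination w i * scalarProd z (C (Pi.single i 1)) * sgn_mul_self i
  refine ⟨LinearEquiv.ofInjectiveEndo D ?_, hD⟩
  rw [← LinearMap.ker_eq_bot, LinearMap.ker_eq_bot']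
  intro z hz
  ext i
  have h1 := hD z (C.symm (Pi.single i 1))
  rw [C.apply_symm_apply, scalarProd_single, hz] at h1
  have h2 : sgn r s i ≠ 0 := by rcases sgn_eq i with h | h <;> simp [h]
  simpa [scalarProd, h2] using h1.symm

end QuadraticForms

/-! ### Rigidity of two representations intertwined on vectors. -/

section Scalars

variable {r s : ℕ} {V : Type*} [AddCommGroup V] [Module ℝ V]

/-- An operator coming from the Clifford algebra and commuting with its action is a scalar if the
volume form acts trivially. -/
theorem exists_eq_algebraMap_of_commute (ρ : Cl r s →ₐ[ℝ] Module.End ℝ V)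
    (hΩ : ρ (volumeForm r s) = 1) (a : Cl r s)
    (ha : ∀ i : Idx r s, Commute (ρ a) (ρ (basisGen i))) :
    ∃ c : ℝ, ρ a = algebraMap ℝ _ c := by
  -- `W S` consists of the words commuting with `z_i` for all `i ∈ S`.
  let W : Finset (Idx r s) → Set (List (Idx r s)) := fun S =>
    {w | ∀ i ∈ S, Even (w.length + w.count i)}
  have hmem : ∀ S : Finset (Idx r s),
      ρ a ∈ Submodule.span ℝ ((fun w => ρ (wordProd w)) '' W S) := by
    intro S
    induction S using Finset.induction_on with
    | empty =>
      have h1 : a ∈ Submodule.span ℝ (Set.range (wordProd : List (Idx r s) → Cl r s)) :=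
        span_words ▸ Submodule.mem_top
      have h2 := Submodule.apply_mem_span_image_of_mem_span ρ.toLinearMap h1
      refine Submodule.span_mono ?_ h2
      rintro _ ⟨_, ⟨w, rfl⟩, rfl⟩
      exact ⟨w, by simp [W], rfl⟩
    | insert i S _ ih =>
      set J := ρ (basisGen i) with hJ
      have hJJ : J * J = algebraMap ℝ _ (-sgn r s i) := by
        rw [hJ, ← map_mul, basisGen_mul_self, AlgHom.commutes]
      -- As `J⁻¹ = -sgn J`, this is `X ↦ X + J X J⁻¹`. It doubles operators commuting with `J` and
      -- kills those anticommuting with it.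
      let avg : Module.End ℝ V →ₗ[ℝ] Module.End ℝ V :=
        LinearMap.id - sgn r s i • (LinearMap.mulLeft ℝ J ∘ₗ LinearMap.mulRight ℝ J)
      have havg : ∀ X, avg X = X - sgn r s i • (J * (X * J)) := fun X => rfl
      have hfix : ρ a = (2⁻¹ : ℝ) • avg (ρ a) := by
        rw [havg, (ha i).eq, ← mul_assoc, hJJ, ← Algebra.smul_def, smul_smul, mul_neg, sgn_mul_self,
          neg_one_smul, sub_neg_eq_add, ← two_smul ℝ (ρ a), smul_smul]
        norm_num
      rw [hfix]
      refine Submodule.smul_mem _ _ ?_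
      have hle : Submodule.map avg (Submodule.span ℝ ((fun w => ρ (wordProd w)) '' W S)) ≤
          Submodule.span ℝ ((fun w => ρ (wordProd w)) '' W (insert i S)) := by
        rw [Submodule.map_span_le]
        rintro _ ⟨w, hw, rfl⟩
        have h1 : J * ρ (wordProd w) = (-1) ^ (w.length + w.count i) * (ρ (wordProd w) * J) := by
          rw [hJ, ← map_mul, basisGen_mul_wordProd]
          simp
        have h2 : avg (ρ (wordProd w)) =
            ρ (wordProd w) + (-1) ^ (w.length + w.count i) * ρ (wordProd w) := by
          rw [havg, ← mul_assoc, h1, mul_assoc, mul_assoc, hJJ, ← Algebra.commutes,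
            ← Algebra.smul_def, mul_smul_comm, smul_smul, mul_neg, sgn_mul_self, neg_one_smul,
            sub_neg_eq_add]
        rw [h2]
        rcases Nat.even_or_odd (w.length + w.count i) with he | ho
        · rw [he.neg_one_pow, one_mul]
          have : ρ (wordProd w) ∈
              Submodule.span ℝ ((fun w => ρ (wordProd w)) '' W (insert i S)) := by
            refine Submodule.subset_span ⟨w, ?_, rfl⟩
            intro j hj
            rcases Finset.mem_insert.1 hj with rfl | hj
            · exact he
            · exact hw j hj
          exact Submodule.add_mem _ this this
        · rw [ho.neg_one_pow, neg_one_mul, add_neg_cancel]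
          exact Submodule.zero_mem _
      exact hle (Submodule.mem_map_of_mem ih)
  have hle : Submodule.span ℝ ((fun w => ρ (wordProd w)) '' W Finset.univ) ≤
      Submodule.span ℝ {1} := by
    rw [Submodule.span_le]
    rintro _ ⟨w, hw, rfl⟩
    -- All letter counts have the parity of the length: all even gives `±1`, all odd gives `±Ω`.
    have h1 : EqUpToSign (wordProd w) 1 ∨ EqUpToSign (wordProd w) (volumeForm r s) := by
      rcases Nat.even_or_odd w.length with he | ho
      · left
        refine wordProd_parity (w' := []) fun i => ?_
        have := (Nat.even_add.1 (hw i (Finset.mem_univ i))).1 he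
        simpa using this
      · right
        refine wordProd_parity (w' := volumeWord r s) fun i => ?_
        have h2 := hw i (Finset.mem_univ i)
        rw [count_volumeWord]
        rw [Nat.even_add', iff_true_left ho] at h2
        simpa using h2
    have h2 : ρ (wordProd w) = 1 ∨ ρ (wordProd w) = -1 := by
      rcases h1 with (h | h) | (h | h) <;> rw [h] <;> simp [hΩ]
    rcases h2 with h2 | h2
    · exact Submodule.mem_span_singleton.2 ⟨1, by simp [h2]⟩
    · exact Submodule.mem_span_singleton.2 ⟨-1, by simp [h2]⟩
  obtain ⟨c, hc⟩ := Submodule.mem_span_singleton.1 (hle (hmem Finset.univ))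
  exact ⟨c, by rw [← hc, Algebra.algebraMap_eq_smul_one]⟩

variable {ρ ρ' : Cl r s →ₐ[ℝ] Module.End ℝ V} {T : Module.End ℝ V}

theorem rep_gen_sq (ρ : Cl r s →ₐ[ℝ] Module.End ℝ V) (z : Vec r s) :
    ρ (gen z) * ρ (gen z) = algebraMap ℝ _ (-quadForm r s z) := by
  rw [← map_mul, gen_mul_self, AlgHom.commutes]

theorem det_rep_gen_sq [FiniteDimensional ℝ V] (ρ : Cl r s →ₐ[ℝ] Module.End ℝ V) (z : Vec r s) :
    LinearMap.det (ρ (gen z)) ^ 2 = (-quadForm r s z) ^ Module.finrank ℝ V := by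
  rw [sq, ← map_mul, rep_gen_sq, Algebra.algebraMap_eq_smul_one, LinearMap.det_smul, map_one,
    mul_one]

/-- Squared determinants of the intertwining relation give `(det T)² |Q z|^N = |Q (D z)|^N` with `N
= dim V`. The factor is therefore `c = (det T)^(2/N)`. -/
theorem exists_quadForm_comp_eq [FiniteDimensional ℝ V] [Nontrivial V] (hodd : Odd (r + s))
    (D : Vec r s →ₗ[ℝ] Vec r s) (hT : LinearMap.det T ≠ 0)
    (h : ∀ z, T * ρ' (gen z) = ρ (gen (D z))) :
    ∃ c : ℝ, 0 < c ∧ ∀ z, quadForm r s (D z) = c * quadForm r s z := by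
  set N := Module.finrank ℝ V with hN
  have hN0 : N ≠ 0 := Module.finrank_pos.ne'
  set δ := LinearMap.det T ^ 2 with hδ
  have hδ0 : 0 < δ := by positivity
  have hcN : (δ ^ ((N : ℝ)⁻¹)) ^ N = δ := Real.rpow_inv_natCast_pow hδ0.le hN0
  refine ⟨δ ^ ((N : ℝ)⁻¹), Real.rpow_pos_of_pos hδ0 _,
    quadForm_comp_eq_of_abs hodd D (Real.rpow_pos_of_pos hδ0 _) fun z => ?_⟩
  have h1 := congrArg (fun X => LinearMap.det X ^ 2) (h z)
  simp only [map_mul, mul_pow, det_rep_gen_sq] at h1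
  have h2 := congrArg abs h1
  rw [← hδ, abs_mul, abs_of_pos hδ0, abs_pow, abs_pow, abs_neg, abs_neg, ← hN] at h2
  nth_rewrite 1 [← hcN] at h2
  rw [← mul_pow] at h2
  exact ((pow_left_inj₀ (by positivity) (abs_nonneg _) hN0).1 h2).symm

/-- Two representations with trivial action of the volume form, intertwined on vectors by an
operator and an isometry, differ by an automorphism of the Clifford algebra. -/
theorem exists_automorphism_of_isometry [Nontrivial V] (hodd : Odd (r + s))
    (hΩ : ρ (volumeForm r s) = 1) (hΩ' : ρ' (volumeForm r s) = 1)
    (D : Vec r s ≃ₗ[ℝ] Vec r s) (hD : ∀ z, quadForm r s (D z) = quadForm r s z)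
    (h : ∀ z, T * ρ' (gen z) = ρ (gen (D z))) :
    ∃ (σ : Cl r s →ₐ[ℝ] Cl r s) (ε : ℝ), ε ≠ 0 ∧ (∀ z : Vec r s, ∃ z', σ (gen z) = gen z') ∧
      (∀ a, ρ' a = ρ (σ a)) ∧ T = algebraMap ℝ _ ε := by
  let σD : Cl r s →ₐ[ℝ] Cl r s := CliffordAlgebra.map
    { toLinearMap := D.toLinearMap
      map_app' z := by simp [hD] }
  have hσD : ∀ z : Vec r s, σD (gen z) = gen (D z) := fun z => CliffordAlgebra.map_apply_ι _ z
  have hb : ∀ i : Idx r s, T * ρ' (basisGen i) = ρ (σD (basisGen i)) := fun i => by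
    rw [basisGen, h, hσD]
  -- Both operators on basis vectors have the same nonzero scalar square, so `hb` can be inverted.
  -- Successive letters then introduce and absorb `T` alternately, giving `hword`.
  have hb' : ∀ i : Idx r s, ρ (σD (basisGen i)) * T = ρ' (basisGen i) := by
    intro i
    have h1 : ρ (σD (basisGen i)) * ρ (σD (basisGen i)) = algebraMap ℝ _ (-sgn r s i) := by
      rw [← map_mul, ← map_mul, basisGen_mul_self, AlgHom.commutes, AlgHom.commutes]
    have h2 : ρ' (basisGen i) * ρ' (basisGen i) = algebraMap ℝ _ (-sgn r s i) := by
      rw [← map_mul, basisGen_mul_self, AlgHom.commutes]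
    have h3 : ρ (σD (basisGen i)) * T * (ρ' (basisGen i) * ρ' (basisGen i)) =
        ρ (σD (basisGen i)) * ρ (σD (basisGen i)) * ρ' (basisGen i) := by
      rw [← hb]
      simp only [mul_assoc]
    rw [h1, h2, ← Algebra.commutes, ← Algebra.smul_def, ← Algebra.smul_def] at h3
    have h4 : -sgn r s i ≠ 0 := by rcases sgn_eq i with h | h <;> simp [h]
    exact smul_right_injective _ h4 h3
  have hword : ∀ w : List (Idx r s),
      (Even w.length → ρ' (wordProd w) = ρ (σD (wordProd w))) ∧
      (Odd w.length → T * ρ' (wordProd w) = ρ (σD (wordProd w))) := by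
    intro w
    induction w with
    | nil => simp
    | cons i w ih =>
      rw [List.length_cons, Nat.even_add_one, Nat.odd_add_one, Nat.not_even_iff_odd,
        Nat.not_odd_iff_even]
      refine ⟨fun hw => ?_, fun hw => ?_⟩
      · rw [wordProd_cons, map_mul, map_mul, map_mul, ← ih.2 hw, ← mul_assoc, hb']
      · rw [wordProd_cons, map_mul, map_mul, map_mul, ← ih.1 hw, ← mul_assoc, hb]
  have hTΩ : T = ρ (σD (volumeForm r s)) := by
    have := (hword (volumeWord r s)).2 (by rwa [length_volumeWord])
    rwa [← volumeForm_eq, hΩ', mul_one] at this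
  -- In odd dimension Ω is central, and `σD` maps the vectors onto the vectors.
  have hcomm : ∀ z : Vec r s, Commute T (ρ (gen z)) := by
    intro z
    obtain ⟨z, rfl⟩ := D.surjective z
    rw [hTΩ, ← hσD, gen_eq_sum]
    refine Commute.map (Commute.map (Commute.sum_right _ _ _ fun i _ => ?_) σD) ρ
    refine Commute.smul_right ?_ _
    have := basisGen_mul_wordProd i (volumeWord r s)
    rw [length_volumeWord, count_volumeWord, (hodd.add_odd odd_one).neg_one_pow, one_mul] at this
    exact this.symm
  obtain ⟨ε, hε⟩ := exists_eq_algebraMap_of_commute ρ hΩ (σD (volumeForm r s))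
    fun i => hTΩ ▸ hcomm _
  rw [← hTΩ] at hε
  obtain ⟨i⟩ : Nonempty (Idx r s) := by
    rw [← Fintype.card_pos_iff]
    simpa using hodd.pos
  have hεε : ε * ε = 1 := by
    have h1 : ρ (σD (basisGen i)) * (T * T) = ρ (σD (basisGen i)) := by
      rw [← mul_assoc, hb', ← hb, hε]
      exact (Algebra.commutes _ _).symm
    have h2 := congrArg (ρ (σD (basisGen i)) * ·) h1
    simp only [← mul_assoc] at h2
    rw [← map_mul, ← map_mul, basisGen_mul_self, AlgHom.commutes, AlgHom.commutes, hε, ← map_mul,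
      ← map_mul] at h2
    have h3 := (algebraMap ℝ (Module.End ℝ V)).injective h2
    have h4 : -sgn r s i ≠ 0 := by rcases sgn_eq i with h | h <;> simp [h]
    apply mul_left_cancel₀ h4
    linarith
  -- With `T = ε = ±1`, the relation reads `ρ' (gen z) = ρ (gen (ε D z))`, and `ε D` is again an
  -- isometry.
  let σ : Cl r s →ₐ[ℝ] Cl r s := CliffordAlgebra.map
    { toLinearMap := ε • D.toLinearMap
      map_app' z := by simp [QuadraticMap.map_smul, hD, hεε] }
  have hσ : ∀ z : Vec r s, σ (gen z) = gen (ε • D z) := fun z => CliffordAlgebra.map_apply_ι _ z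
  refine ⟨σ, ε, fun h0 => by simp [h0] at hεε, fun z => ⟨_, hσ z⟩, fun a => ?_, hε⟩
  have : ρ' = ρ.comp σ := by
    refine CliffordAlgebra.hom_ext (LinearMap.ext fun z => ?_)
    change ρ' (gen z) = ρ (σ (gen z))
    rw [hσ, map_smul, map_smul, ← h, hε, ← Algebra.smul_def, smul_smul, hεε, one_smul]
  rw [this]
  rfl

end Scalars

/-! ### The classification -/

section Classification

open HTypeAlgebra

variable {r s : ℕ}
  {U : Type*} [AddCommGroup U] [Module ℝ U] [Module (Cl r s) U] [IsScalarTower ℝ (Cl r s) U]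
  {U' : Type*} [AddCommGroup U'] [Module ℝ U'] [Module (Cl r s) U'] [IsScalarTower ℝ (Cl r s) U']
  {g : AdmissibleForm r s U} {g' : AdmissibleForm r s U'}

/-- If the volume form acts trivially, isomorphic pseudo `H`-type Lie algebras come from modules
which are isomorphic up to scaling the form and an automorphism of the Clifford algebra. -/
theorem exists_equiv_of_lieEquiv [FiniteDimensional ℝ U] [Nontrivial U] (hodd : Odd (r + s))
    (hΩ : ∀ x : U, volumeForm r s • x = x) (hΩ' : ∀ x : U', volumeForm r s • x = x)
    (Φ : HTypeAlgebra g ≃ₗ⁅ℝ⁆ HTypeAlgebra g') :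
    ∃ (A : U ≃ₗ[ℝ] U') (σ : Cl r s →ₐ[ℝ] Cl r s) (ε : ℝ), ε ≠ 0 ∧
      (∀ z : Vec r s, ∃ z', σ (gen z) = gen z') ∧
      (∀ (a : Cl r s) x, a • A x = A (σ a • x)) ∧
      ∀ x y, g'.form (A x) (A y) = ε * g.form x y := by
  obtain ⟨A, C, hAC⟩ := exists_bracket_of_lieEquiv hodd.pos Φ
  obtain ⟨D, hD⟩ := exists_scalarProd_adjoint C
  have hAD : ∀ z x y, g'.form ((gen z : Cl r s) • A x) (A y) =
      g.form ((gen (D z) : Cl r s) • x) y := by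
    intro z x y
    rw [form_gen_smul, form_gen_smul, hAC, hD]
  have hnd : g.form.Nondegenerate :=
    ⟨g.nondegenerate, fun y hy => g.nondegenerate y fun x => by rw [g.symm, hy]⟩
  -- `T` represents the form pulled back along `A` with respect to `g`. That `A` scales the form
  -- means exactly that `T` is a scalar.
  let T : Module.End ℝ U := (g.form.toDual hnd).symm.toLinearMap ∘ₗ g'.form.compl₁₂ A.toLinearMap
    A.toLinearMap
  have hT : ∀ x y, g.form (T x) y = g'.form (A x) (A y) := fun x y =>
    LinearMap.BilinForm.apply_toDual_symm_apply (hB := hnd)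
      (g'.form.compl₁₂ A.toLinearMap A.toLinearMap x) y
  let ρ' : Cl r s →ₐ[ℝ] Module.End ℝ U := (A.symm.conjAlgEquiv ℝ).toAlgHom.comp (rep r s U')
  have hρ' : ∀ a x, ρ' a x = A.symm (a • A x) := fun a x => rfl
  have hTgen : ∀ z, T * ρ' (gen z) = rep r s U (gen (D z)) := by
    intro z
    ext x
    refine sub_eq_zero.1 (g.nondegenerate _ fun y => ?_)
    rw [map_sub, LinearMap.sub_apply, Module.End.mul_apply, hT, hρ', A.apply_symm_apply, hAD,
      rep_apply, sub_self]
  have hTdet : LinearMap.det T ≠ 0 := by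
    intro h
    obtain ⟨x, hx0, hx⟩ := Submodule.exists_mem_ne_zero_of_ne_bot
      (LinearMap.bot_lt_ker_of_det_eq_zero h).ne'
    refine hx (A.map_eq_zero_iff.1 (g'.nondegenerate _ fun y => ?_))
    rw [← A.apply_symm_apply y, ← hT, LinearMap.mem_ker.1 hx0, map_zero, LinearMap.zero_apply]
  obtain ⟨c, hc, hcD⟩ := exists_quadForm_comp_eq hodd D.toLinearMap hTdet hTgen
  have hsq : √c * √c = c := Real.mul_self_sqrt hc.le
  have hsc : (√c)⁻¹ ≠ 0 := inv_ne_zero (Real.sqrt_pos.2 hc).ne'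
  obtain ⟨σ, ε, hε, hσ, hρσ, hTε⟩ := exists_automorphism_of_isometry (ρ := rep r s U) (ρ' := ρ')
    (T := (√c)⁻¹ • T) hodd (by ext x; simp [hΩ]) (by ext x; simp [hρ', hΩ'])
    (D.trans (LinearEquiv.smulOfNeZero ℝ _ _ hsc)) (fun z => by
      have := hcD z
      rw [LinearEquiv.coe_coe] at this
      rw [LinearEquiv.trans_apply, LinearEquiv.smulOfNeZero_apply, QuadraticMap.map_smul, this,
        smul_eq_mul, ← mul_inv, hsq, inv_mul_cancel_left₀ hc.ne'])
    (fun z => by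
      rw [smul_mul_assoc, hTgen, LinearEquiv.trans_apply, LinearEquiv.smulOfNeZero_apply, map_smul,
        map_smul])
  refine ⟨A, σ, √c * ε, mul_ne_zero (Real.sqrt_pos.2 hc).ne' hε, hσ, fun a x => ?_, fun x y => ?_⟩
  · have := LinearMap.congr_fun (hρσ a) x
    rw [hρ', rep_apply, LinearEquiv.symm_apply_eq] at this
    exact this
  · have h1 : T x = (√c * ε) • x := by
      have := LinearMap.congr_fun hTε x
      rw [LinearMap.smul_apply, Module.algebraMap_end_apply] at this
      rw [mul_smul, ← this, smul_inv_smul₀ (Real.sqrt_pos.2 hc).ne']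
    rw [← hT, h1, map_smul, LinearMap.smul_apply, smul_eq_mul]

variable {Vp : Type*} [AddCommGroup Vp] [Module ℝ Vp] [Module (Cl r s) Vp]
  [IsScalarTower ℝ (Cl r s) Vp] {gp : AdmissibleForm r s Vp}
  {k : ℕ} {P : Fin (k + 1) → List (Idx r s)}

/-- The common `1`-eigenspace, as a linear subspace. -/
def commonEigensubspace (P : Fin (k + 1) → List (Idx r s)) (V : Type*) [AddCommGroup V]
    [Module ℝ V] [Module (Cl r s) V] [IsScalarTower ℝ (Cl r s) V] : Submodule ℝ V where
  carrier := commonEigenspace P V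
  add_mem' hx hy i := by rw [smul_add, hx i, hy i]
  zero_mem' i := smul_zero _
  smul_mem' c x hx i := by
    rw [← rep_apply, map_smul, rep_apply, hx i]

/-- Being Clifford-linear, `F` preserves the fixed vectors of the involutions. On the positive part
`E^p` its projection to `E^{p'}` is injective: a kernel vector would have nonnegative norm and an
image of nonpositive norm. Dividing dimensions by `dim E > 0` gives the bound. -/
theorem le_of_form_scaling (hP : IsInvolutionSystem P) [FiniteDimensional ℝ Vp] [Nontrivial Vp]
    (hEp : ∀ v ∈ commonEigenspace P Vp, v ≠ 0 → 0 < gp.form v v) {p q p' q' : ℕ}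
    (F : ((Fin p → Vp) × (Fin q → Vp)) →ₗ[ℝ] ((Fin p' → Vp) × (Fin q' → Vp)))
    (hF : ∀ (a : Cl r s) x, F (a • x) = a • F x) {δ : ℝ} (hδ : 0 < δ)
    (hform : ∀ x, (gp.signedCopies p' q').form (F x) (F x) = δ * (gp.signedCopies p q).form x x) :
    p ≤ p' := by
  have := nontrivial_cl (r := r) (s := s) Vp
  set E := commonEigensubspace P Vp with hE
  have hE0 : ∀ x ∈ E, 0 ≤ gp.form x x := fun x hx => by
    rcases eq_or_ne x 0 with rfl | h
    · simp
    · exact (hEp x hx h).le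
  have hEF : ∀ x : Fin p → E, F (fun i => x i, 0) ∈
      {y : (Fin p' → Vp) × (Fin q' → Vp) | (∀ i, y.1 i ∈ E) ∧ ∀ i, y.2 i ∈ E} := by
    intro x
    have h : ∀ l : Fin k, wordProd (P l.castSucc) • F (fun i => (x i : Vp), 0) =
        F (fun i => x i, 0) := by
      intro l
      rw [← hF]
      congr 1
      exact Prod.ext (funext fun i => (x i).2 l) (smul_zero _)
    exact ⟨fun i l => congrFun (congrArg Prod.fst (h l)) i,
      fun i l => congrFun (congrArg Prod.snd (h l)) i⟩
  let f : (Fin p → E) →ₗ[ℝ] (Fin p' → E) :=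
    { toFun x i := ⟨(F (fun i => x i, 0)).1 i, (hEF x).1 i⟩
      map_add' x y := by
        ext i
        have : ((fun i => ((x + y) i : Vp), 0) : (Fin p → Vp) × (Fin q → Vp)) =
            (fun i => (x i : Vp), 0) + (fun i => (y i : Vp), 0) := by
          ext <;> simp
        simp only [this, map_add]
        rfl
      map_smul' c x := by
        ext i
        have : ((fun i => ((c • x) i : Vp), 0) : (Fin p → Vp) × (Fin q → Vp)) =
            c • (fun i => (x i : Vp), 0) := by
          ext <;> simp
        simp only [this, map_smul]
        rfl }
  have hf : Function.Injective f := by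
    rw [← LinearMap.ker_eq_bot, LinearMap.ker_eq_bot']
    intro x hx
    have h1 : ∀ i, (F (fun i => (x i : Vp), 0)).1 i = 0 := fun i =>
      congrArg Subtype.val (congrFun hx i)
    have h2 := hform (fun i => (x i : Vp), 0)
    rw [AdmissibleForm.signedCopies_apply, AdmissibleForm.signedCopies_apply] at h2
    simp only [h1, map_zero, Finset.sum_const_zero, zero_sub, Pi.zero_apply, sub_zero] at h2
    have h3 : 0 ≤ ∑ j, gp.form ((F (fun i => (x i : Vp), 0)).2 j)
        ((F (fun i => (x i : Vp), 0)).2 j) :=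
      Finset.sum_nonneg fun j _ => hE0 _ ((hEF x).2 j)
    have h4 : ∀ i ∈ Finset.univ, 0 ≤ gp.form (x i) (x i) := fun i _ => hE0 _ (x i).2
    have h5 : ∑ i, gp.form (x i) (x i) = 0 := by
      have := Finset.sum_nonneg h4
      nlinarith
    ext i
    by_contra h
    have h6 := (Finset.sum_eq_zero_iff_of_nonneg h4).1 h5 i (Finset.mem_univ i)
    exact (hEp _ (x i).2 h).ne' h6
  have hE1 : 0 < Module.finrank ℝ E := by
    obtain ⟨x, hx0, hx⟩ := hP.isInvolutionGroup.exists_fixed (rep r s Vp)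
    have : Nontrivial E :=
      ⟨⟨x, mem_commonEigenspace_of_fixed subset_rfl hx⟩, 0, fun h => hx0 (congrArg Subtype.val h)⟩
    exact Module.finrank_pos
  have hle := LinearMap.finrank_le_finrank_of_injective hf
  rw [Module.finrank_pi_fintype, Module.finrank_pi_fintype, Finset.sum_const, Finset.sum_const,
    Finset.card_univ, Finset.card_univ, Fintype.card_fin, Fintype.card_fin, smul_eq_mul,
    smul_eq_mul] at hle
  exact Nat.le_of_mul_le_mul_right hle hE1

theorem eq_of_form_scaling (hP : IsInvolutionSystem P) [FiniteDimensional ℝ Vp] [Nontrivial Vp]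
    (hEp : ∀ v ∈ commonEigenspace P Vp, v ≠ 0 → 0 < gp.form v v) {p q p' q' : ℕ}
    (F : ((Fin p → Vp) × (Fin q → Vp)) ≃ₗ[ℝ] ((Fin p' → Vp) × (Fin q' → Vp)))
    (hF : ∀ (a : Cl r s) x, F (a • x) = a • F x) {δ : ℝ} (hδ : 0 < δ)
    (hform : ∀ x, (gp.signedCopies p' q').form (F x) (F x) = δ * (gp.signedCopies p q).form x x) :
    p = p' := by
  refine le_antisymm (le_of_form_scaling hP hEp F.toLinearMap hF hδ hform)
    (le_of_form_scaling hP hEp F.symm.toLinearMap (fun a x => ?_) (inv_pos.2 hδ) fun x => ?_)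
  · rw [LinearEquiv.coe_coe, LinearEquiv.symm_apply_eq, hF, LinearEquiv.apply_symm_apply]
  · have := hform (F.symm x)
    rw [LinearEquiv.apply_symm_apply] at this
    rw [this, LinearEquiv.coe_coe, inv_mul_cancel_left₀ hδ.ne']

theorem signedCopies_swap (gp : AdmissibleForm r s Vp) (p q : ℕ)
    (x : (Fin p → Vp) × (Fin q → Vp)) :
    (gp.signedCopies q p).form x.swap x.swap = -(gp.signedCopies p q).form x x := by
  rw [AdmissibleForm.signedCopies_apply, AdmissibleForm.signedCopies_apply, neg_sub]
  rfl

theorem nonempty_lieEquiv_signedCopies_iff (hodd : Odd (r + s)) (hP : IsInvolutionSystem P)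
    (hgp : gp.IsMinimal) (hΩp : ∀ v : Vp, volumeForm r s • v = v)
    (hEp : ∀ v ∈ commonEigenspace P Vp, v ≠ 0 → 0 < gp.form v v) (p q p' q' : ℕ) :
    Nonempty (HTypeAlgebra (gp.signedCopies p q) ≃ₗ⁅ℝ⁆ HTypeAlgebra (gp.signedCopies p' q')) ↔
      (p = p' ∧ q = q') ∨ (p = q' ∧ q = p') := by
  have hnon := hgp.1
  have hfin := hgp.2.1
  constructor
  · rintro ⟨Φ⟩
    have hsum : p + q = p' + q' := by
      obtain ⟨A, -⟩ := exists_bracket_of_lieEquiv hodd.pos Φ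
      have h := A.finrank_eq
      rw [Module.finrank_prod, Module.finrank_prod, Module.finrank_pi_fintype,
        Module.finrank_pi_fintype, Module.finrank_pi_fintype, Module.finrank_pi_fintype] at h
      simp only [Finset.sum_const, Finset.card_univ, Fintype.card_fin, smul_eq_mul,
        ← add_mul] at h
      exact Nat.eq_of_mul_eq_mul_right Module.finrank_pos h
    rcases Nat.eq_zero_or_pos (p + q) with h0 | hpos
    · omega
    have hcomp : Nonempty (Fin p ⊕ Fin q) := by
      rw [← Fintype.card_pos_iff]
      simpa using hpos
    -- One summand suffices to read off on `Vp` that `σ Ω` acts trivially.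
    obtain ⟨incl, proj, hproj, hproj_smul⟩ : ∃ (incl : Vp → (Fin p → Vp) × (Fin q → Vp))
        (proj : (Fin p → Vp) × (Fin q → Vp) → Vp), (∀ v, proj (incl v) = v) ∧
        ∀ (a : Cl r s) x, proj (a • x) = a • proj x := by
      obtain ⟨j | j⟩ := hcomp
      · exact ⟨fun v => (fun _ => v, 0), fun x => x.1 j, fun v => rfl, fun a x => rfl⟩
      · exact ⟨fun v => (0, fun _ => v), fun x => x.2 j, fun v => rfl, fun a x => rfl⟩
    have : Nontrivial ((Fin p → Vp) × (Fin q → Vp)) :=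
      (Function.LeftInverse.injective hproj).nontrivial
    obtain ⟨A, σ, ε, hε, hσ, hA, hA'⟩ := exists_equiv_of_lieEquiv hodd
      (fun x => Prod.ext (funext fun i => hΩp _) (funext fun i => hΩp _))
      (fun x => Prod.ext (funext fun i => hΩp _) (funext fun i => hΩp _)) Φ
    have hΩσ : ∀ v : Vp, σ (volumeForm r s) • v = v := by
      intro v
      have h1 := hA (volumeForm r s) (incl v)
      have h2 : volumeForm r s • A (incl v) = A (incl v) :=
        Prod.ext (funext fun i => hΩp _) (funext fun i => hΩp _)
      rw [h2] at h1
      have h3 := congrArg proj (A.injective h1)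
      rw [hproj_smul, hproj] at h3
      exact h3.symm
    -- Applying `φ` in every summand before `A` cancels the twist by σ.
    obtain ⟨φ, c, hc, hφ, hφ'⟩ := exists_twisted_automorphism hodd hP hgp hΩp hEp σ hσ hΩσ
    let φφ : ((Fin p → Vp) × (Fin q → Vp)) ≃ₗ[ℝ] ((Fin p → Vp) × (Fin q → Vp)) :=
      (LinearEquiv.piCongrRight fun _ => φ).prodCongr (LinearEquiv.piCongrRight fun _ => φ)
    have hφφ : ∀ (a : Cl r s) x, φφ (a • x) = σ a • φφ x := fun a x =>
      Prod.ext (funext fun i => hφ a _) (funext fun i => hφ a _)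
    have hF : ∀ (a : Cl r s) x, (φφ.trans A) (a • x) = a • (φφ.trans A) x := by
      intro a x
      rw [LinearEquiv.trans_apply, LinearEquiv.trans_apply, hφφ, hA]
    have hF' : ∀ x, (gp.signedCopies p' q').form ((φφ.trans A) x) ((φφ.trans A) x) =
        (ε * c) * (gp.signedCopies p q).form x x := by
      intro x
      rw [LinearEquiv.trans_apply, hA', mul_assoc]
      congr 1
      rw [AdmissibleForm.signedCopies_apply, AdmissibleForm.signedCopies_apply, mul_sub,
        Finset.mul_sum, Finset.mul_sum]
      congr 1
      · exact Finset.sum_congr rfl fun i _ => hφ' _ _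
      · exact Finset.sum_congr rfl fun i _ => hφ' _ _
    -- A negative scaling factor becomes positive after exchanging the two blocks of the target,
    -- which is the crossed alternative.
    rcases lt_or_gt_of_ne (mul_ne_zero hε hc) with hneg | hpos
    · right
      have := eq_of_form_scaling hP hEp
        ((φφ.trans A).trans (LinearEquiv.prodComm ℝ (Fin p' → Vp) (Fin q' → Vp)))
        (fun a x => congrArg Prod.swap (hF a x)) (δ := -(ε * c)) (by linarith)
        (fun x => (signedCopies_swap gp p' q' ((φφ.trans A) x)).trans (by rw [hF', neg_mul]))
      omega
    · left
      have := eq_of_form_scaling hP hEp (φφ.trans A) hF hpos hF'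
      omega
  · rintro (⟨rfl, rfl⟩ | ⟨rfl, rfl⟩)
    · exact ⟨LieEquiv.refl⟩
    · exact nonempty_lieEquiv_signedCopies_swap gp p q

end Classification

end PseudoHType

open PseudoHType in
theorem mainTheorem2 {r s : ℕ} (hr : r % 4 = 3) (hs : s % 4 = 0)
    -- a system of involutions, the same one for all modules
    {k : ℕ} (P : Fin (k + 1) → List (Idx r s)) (hP : IsInvolutionSystem P)
    -- `V^{r,s;+}_{min;+}`
    {Vp : Type*} [AddCommGroup Vp] [Module ℝ Vp] [Module (Cl r s) Vp]
    [IsScalarTower ℝ (Cl r s) Vp] (gp : AdmissibleForm r s Vp) (hgp : gp.IsMinimal)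
    (hΩp : ∀ v : Vp, volumeForm r s • v = v)
    (hEp : ∀ v ∈ commonEigenspace P Vp, v ≠ 0 → 0 < gp.form v v)
    -- `V^{r,s;+}_{min;-}`
    {Vm : Type*} [AddCommGroup Vm] [Module ℝ Vm] [Module (Cl r s) Vm]
    [IsScalarTower ℝ (Cl r s) Vm] (gm : AdmissibleForm r s Vm) (hgm : gm.IsMinimal)
    (hΩm : ∀ v : Vm, volumeForm r s • v = -v)
    (hEm : ∀ v ∈ commonEigenspace P Vm, v ≠ 0 → 0 < gm.form v v)
    -- the admissible module `U` and its decomposition; the name `pab` stands for `p^a_b`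
    {U : Type*} [AddCommGroup U] [Module ℝ U] [Module (Cl r s) U]
    [IsScalarTower ℝ (Cl r s) U] (g : AdmissibleForm r s U) (ppp pmp ppm pmm : ℕ)
    (hU : g.Iso ((gp.copies ppp).prod ((gp.neg.copies pmp).prod
      ((gm.copies ppm).prod (gm.neg.copies pmm)))))
    -- the admissible module `Ũ` and its decomposition
    {U' : Type*} [AddCommGroup U'] [Module ℝ U'] [Module (Cl r s) U']
    [IsScalarTower ℝ (Cl r s) U'] (g' : AdmissibleForm r s U') (ppp' pmp' ppm' pmm' : ℕ)
    (hU' : g'.Iso ((gp.copies ppp').prod ((gp.neg.copies pmp').prod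
      ((gm.copies ppm').prod (gm.neg.copies pmm'))))) :
    Nonempty (HTypeAlgebra g ≃ₗ⁅ℝ⁆ HTypeAlgebra g') ↔
      (ppp + pmm = ppp' + pmm' ∧ pmp + ppm = pmp' + ppm') ∨
      (ppp + pmm = pmp' + ppm' ∧ pmp + ppm = ppp' + pmm') := by
  have hodd : Odd (r + s) := by rw [Nat.odd_iff]; omega
  obtain ⟨A, hA, hA'⟩ := exists_antilinear_isometry hodd hP hgp hΩp hEp hgm hΩm hEm
  obtain ⟨e⟩ := nonempty_lieEquiv_of_isometry A hA hA' ppp pmp ppm pmm hU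
  obtain ⟨e'⟩ := nonempty_lieEquiv_of_isometry A hA hA' ppp' pmp' ppm' pmm' hU'
  rw [← nonempty_lieEquiv_signedCopies_iff hodd hP hgp hΩp hEp]
  exact ⟨fun ⟨f⟩ => ⟨(e.trans f).trans e'.symm⟩, fun ⟨f⟩ => ⟨(e.symm.trans f).trans e'⟩⟩
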